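/- Let $X$ be a real Banach space with $\dim X\ge 2$, and let $\lambda,\mu>0$ and $1\le p<\infty$ be real numbers. Put $$C^p_{-\infty}(\lambda,\mu,X)=\sup\left\{\frac{\min\{\|\lambda x_1+\mu x_2\|^p,\ \|\mu x_1-\lambda x_2\|^p\}}{2^{p-3}(\lambda^p+\mu^p)(\|x_1\|^p+\|x_2\|^p)} : x_1,x_2\in X,\ (x_1,x_2)\ne(0,0)\right\},$$ and let $$\omega(X)=\inf\left\{t>0 : \liminf_{n\to\infty}\|u_n+x\|\le t\,\liminf_{n\to\infty}\|u_n-x\|\ \text{ for all weakly null sequences } (u_n) \text{ in } X \text{ and all } x\in X\right\}$$ be the coefficient of weak orthogonality of $X$ (so that $1\le\omega(X)\le 3$). Suppose that $$C^p_{-\infty}(\lambda,\mu,X)<\frac{\left[\min\{\lambda,\mu\}\,(\omega(X)^2+1)-|\lambda-\mu|\,\omega(X)\right]^p}{2^{p-3}(\lambda^p+\mu^p)\,\omega(X)^p\,(\omega(X)^p+1)},$$ where the bracket is understood to be nonnegative if $p$ is not an integer. Let $C$ be a nonempty bounded closed convex subset of $X$, let $KC(C)$ be the family of nonempty compact convex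 subsets of $C$, and let $T:C\to KC(C)$ be a multivalued nonexpansive mapping, that is, $H(Tx,Ty)\le\|x-y\|$ for all $x,y\in C$, where $H$ is the Hausdorff distance. Then $T$ has a fixed point: there is $x\in C$ with $x\in Tx$. -/

import Mathlib

open Filter Topology

namespace SkewVNJ

/-- The skew generalized von Neumann-Jordan type constant `C^p_{-∞}(lam, mu, X)`. The set is
nonempty in a nonzero space and bounded above whenever `lam, mu > 0` and `1 ≤ p`. -/
noncomputable def skewConst (p lam mu : ℝ) (X : Type*) [NormedAddCommGroup X] [NormedSpace ℝ X] :
    ℝ :=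
  sSup {c : ℝ | ∃ x₁ x₂ : X, (x₁, x₂) ≠ (0, 0) ∧
    c = min (‖lam • x₁ + mu • x₂‖ ^ p) (‖mu • x₁ - lam • x₂‖ ^ p) /
      ((2 : ℝ) ^ (p - 3) * (lam ^ p + mu ^ p) * (‖x₁‖ ^ p + ‖x₂‖ ^ p))}

/-- The sequence `u` converges weakly to zero. -/
def WeaklyNull {X : Type*} [NormedAddCommGroup X] [NormedSpace ℝ X] (u : ℕ → X) : Prop :=
  ∀ f : X →L[ℝ] ℝ, Tendsto (fun n => f (u n)) atTop (𝓝 0)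

/-- The coefficient of weak orthogonality `ω(X)`: the least constant `t` such that
`liminf ‖u n + x‖ ≤ t * liminf ‖u n - x‖` for all weakly null sequences `u` and all `x`.
Weakly null sequences are bounded, so these are genuine (finite) lower limits; in a nonzero
Banach space one has `1 ≤ ω(X) ≤ 3`. -/
noncomputable def weakOrthCoeff (X : Type*) [NormedAddCommGroup X] [NormedSpace ℝ X] : ℝ :=
  sInf {t : ℝ | 0 < t ∧ ∀ u : ℕ → X, WeaklyNull u → ∀ x : X,
    liminf (fun n => ‖u n + x‖) atTop ≤ t * liminf (fun n => ‖u n - x‖) atTop}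

/-- `T` maps each point of `C` into `KC(C)`, the family of nonempty compact convex subsets
of `C`. -/
def MapsToKC {X : Type*} [NormedAddCommGroup X] [NormedSpace ℝ X] (T : X → Set X) (C : Set X) :
    Prop :=
  ∀ x ∈ C, (T x).Nonempty ∧ IsCompact (T x) ∧ Convex ℝ (T x) ∧ T x ⊆ C

/-- `T` is multivalued nonexpansive on `C`: `H(T x, T y) ≤ ‖x - y‖` for the Hausdorff distance
`H` and all `x, y ∈ C`. -/
def MultiNonexpansiveOn {X : Type*} [NormedAddCommGroup X] (T : X → Set X) (C : Set X) : Prop :=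
  ∀ x ∈ C, ∀ y ∈ C, Metric.hausdorffDist (T x) (T y) ≤ ‖x - y‖

end SkewVNJ

/-! Write `ω` for the weak orthogonality coefficient, `β` for the bracket and `c` for the skew
constant times `2 ^ (p - 3) * (lam ^ p + mu ^ p)`. The hypothesis becomes `c * ω ^ p * (ω ^ p + 1) <
β ^ p`, and it is used twice.

First, testing the skew inequality on `x₁ = x₂` rules out `β ≤ 0`, and convexity of `t ^ p` then
gives `2 * c < (lam + mu) ^ p`. This makes `X` uniformly nonsquare (`SkewIneq.nonsquare`), so by
James' theorem (`exists_weak_ulim`) bounded sequences have weak limits along ultrafilters.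

Second, let `z` be an asymptotic center in `C` of a bounded sequence `x n` with weak limit `w ∈ C`,
and let `r` be the asymptotic radius. Applying the skew inequality to `ω² (x n - z)` and `x n - 2w +
z` gives `‖w - z‖ ≤ κ r` with a fixed `κ < 1` (`SkewIneq.dist_weakLim_le`). The coefficient `ω`
bounds the second vector; minimality of `z` and weak lower semicontinuity bound the two combinations
from below.

Such an estimate yields fixed points (`exists_fixed_of_asymptotic_centers`). The asymptotic center
of an approximate fixed point sequence is a closed convex set that meets `T z` for each of its
points `z`, so it contains a new approximate fixed point sequence, all of it within `κ r` of `w`.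
Iterating produces a Cauchy sequence of points ever closer to approximate fixed point sequences, and
its limit is a fixed point.

Approximate fixed points in a set `A` that the values only meet (`exists_approx_fixed`) do not come
from the contraction principle, since a nearest point selection may leave `A`. Shrinking `T` towards
a point gives a set contraction, which has a compact convex set that its values meet; there a
partition of unity and Brouwer's theorem apply. Brouwer's theorem is itself derived from a
combinatorial lemma of Scarf type. -/

namespace Scarf

/-! ### Dominant sets for several rankings, and their completions. -/

section Orders

variable {I V : Type*}

/-- With respect to the rankings `r i`, no element lies strictly above all minima of `S`. -/
def Dominant (r : I → V → ℕ) (S : Finset V) : Prop :=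
  ∀ t, ∃ i, ∀ s ∈ S, r i t ≤ r i s

theorem Dominant.mono {r : I → V → ℕ} {S S' : Finset V} (h : Dominant r S) (hs : S' ⊆ S) :
    Dominant r S' := fun t => (h t).imp fun _ hi s hs' => hi s (hs hs')

/-- `v` is the `i`-largest among the elements above `m l` in every ranking `l ≠ i`. -/
def IsCompletion (r : I → V → ℕ) (m : I → V) (i : I) (v : V) : Prop :=
  (∀ l, l ≠ i → r l (m l) < r l v) ∧ ∀ t, (∀ l, l ≠ i → r l (m l) < r l t) → r i t ≤ r i v

theorem IsCompletion.unique {r : I → V → ℕ} (hr : ∀ i, Function.Injective (r i)) {m : I → V}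
    {i : I} {v w : V} (hv : IsCompletion r m i v) (hw : IsCompletion r m i w) : v = w :=
  hr i (le_antisymm (hw.2 v hv.1) (hv.2 w hw.1))

theorem exists_isCompletion [Finite V] {r : I → V → ℕ} {m : I → V} {i : I}
    (h : ∃ t, ∀ l, l ≠ i → r l (m l) < r l t) : ∃ v, IsCompletion r m i v := by
  obtain ⟨v, hv, hmax⟩ := Set.exists_max_image {t | ∀ l, l ≠ i → r l (m l) < r l t} (r i)
    (Set.toFinite _) h
  exact ⟨v, hv, hmax⟩

/-- The two rankings in which a dominant set with one element less than the number of rankings has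
the same minimum, and the elements by which it can be completed. -/
theorem exists_pair_completions [Fintype I] [DecidableEq I] [DecidableEq V] {r : I → V → ℕ}
    (hr : ∀ i, Function.Injective (r i)) {D : Finset V} (hD : Dominant r D)
    (hcard : D.card + 1 = Fintype.card I) {m : I → V} (hmD : ∀ i, m i ∈ D)
    (hmin : ∀ i, ∀ s ∈ D, r i (m i) ≤ r i s) :
    ∃ i j, i ≠ j ∧ m i = m j ∧ ∀ v, (v ∉ D ∧ Dominant r (insert v D)) ↔
      (IsCompletion r m i v ∨ IsCompletion r m j v) := by
  -- Dominance tested at an element of `D` makes that element a minimum in some ranking. So `m` maps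
  -- onto a set with one element fewer than there are rankings, and identifies exactly one pair.
  have hsurj : ∀ t ∈ D, ∃ i, m i = t := fun t ht => by
    obtain ⟨i, hi⟩ := hD t
    exact ⟨i, hr i (le_antisymm (hmin i t ht) (hi _ (hmD i)))⟩
  obtain ⟨i, -, j, -, hij, hmij⟩ := Finset.exists_ne_map_eq_of_card_lt_of_maps_to
    (s := Finset.univ) (t := D) (f := m) (by rw [Finset.card_univ]; omega) (fun i _ => hmD i)
  have hinj : ∀ i j, i ≠ j → m i = m j → Set.InjOn m (Finset.univ.erase i : Finset I) := by
    intro i j hij hmij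
    refine Finset.injOn_of_surjOn_of_card_le (t := D) m (fun a _ => hmD a) ?_ ?_
    · intro t ht
      obtain ⟨k, rfl⟩ := hsurj t ht
      by_cases hk : k = i
      · exact ⟨j, by simpa using hij.symm, by rw [hk, hmij]⟩
      · exact ⟨k, by simpa using hk, rfl⟩
    · rw [Finset.card_erase_of_mem (Finset.mem_univ _), Finset.card_univ]; omega
  have hpair : ∀ a b, m a = m b → a ≠ b → (a = i ∧ b = j) ∨ (a = j ∧ b = i) := by
    intro a b hab hne
    have h1 : a = i ∨ b = i := by
      by_contra! h
      exact hne (hinj i j hij hmij (by simpa using h.1) (by simpa using h.2) hab)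
    have h2 : a = j ∨ b = j := by
      by_contra! h
      exact hne (hinj j i hij.symm hmij.symm (by simpa using h.1) (by simpa using h.2) hab)
    grind
  have hback : ∀ i j, i ≠ j → m i = m j → ∀ v, IsCompletion r m i v →
      v ∉ D ∧ Dominant r (insert v D) := by
    intro i j hij hmij v hv
    have hvD : v ∉ D := by
      intro hvD
      obtain ⟨l, rfl⟩ := hsurj v hvD
      by_cases hl : l = i
      · have := hv.1 j hij.symm
        rw [hl, hmij] at this
        exact lt_irrefl _ this
      · exact lt_irrefl _ (hv.1 l hl)
    refine ⟨hvD, fun t => ?_⟩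
    by_cases ht : ∀ l, l ≠ i → r l (m l) < r l t
    · refine ⟨i, fun s hs => ?_⟩
      rcases Finset.mem_insert.1 hs with rfl | hs
      · exact hv.2 t ht
      · obtain ⟨l, hl⟩ := hD v
        by_cases hli : l = i
        · subst hli
          exact (hv.2 t ht).trans (hl s hs)
        · exact absurd (hl _ (hmD l)) (not_le.2 (hv.1 l hli))
    · push Not at ht
      obtain ⟨l, hli, hl⟩ := ht
      refine ⟨l, fun s hs => ?_⟩
      rcases Finset.mem_insert.1 hs with rfl | hs
      · exact hl.trans (hv.1 l hli).le
      · exact hl.trans (hmin l s hs)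
  -- If `v` takes over as minimum in ranking `i` while `m j` keeps ranking `j`, the minima in all
  -- other rankings must survive too, since each old element needs a ranking in which it is still
  -- lowest.
  have hforw : ∀ i j, i ≠ j → m i = m j →
      (∀ a b, m a = m b → a ≠ b → (a = i ∧ b = j) ∨ (a = j ∧ b = i)) →
      ∀ v, v ∉ D → Dominant r (insert v D) → (∀ s ∈ D, r i v ≤ r i s) →
      (∀ s ∈ insert v D, r j (m j) ≤ r j s) → IsCompletion r m i v := by
    intro i j hij hmij hpair v hvD hdom hvi hvj
    have hlow : ∀ l, l ≠ i → r l (m l) < r l v := by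
      intro l hli
      have hle : r l (m l) ≤ r l v := by
        by_cases hlj : l = j
        · subst hlj
          exact hvj v (Finset.mem_insert_self _ _)
        · obtain ⟨l', hl'⟩ := hdom (m l)
          have : m l' = m l := hr l' (le_antisymm (hmin l' _ (hmD l))
            (hl' _ (Finset.mem_insert_of_mem (hmD l'))))
          by_cases hll : l' = l
          · subst hll
            exact hl' v (Finset.mem_insert_self _ _)
          · rcases hpair l' l this hll with h | h
            · exact absurd h.2 hlj
            · exact absurd h.2 hli
      refine lt_of_le_of_ne hle fun h => hvD ?_
      rw [← hr l h]
      exact hmD l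
    refine ⟨hlow, fun t ht => ?_⟩
    obtain ⟨l, hl⟩ := hdom t
    by_cases hli : l = i
    · subst hli
      exact hl v (Finset.mem_insert_self _ _)
    · exact absurd (hl _ (Finset.mem_insert_of_mem (hmD l))) (not_le.2 (ht l hli))
  refine ⟨i, j, hij, hmij, fun v => ⟨fun ⟨hvD, hdom⟩ => ?_, fun h => ?_⟩⟩
  · obtain ⟨k, hk⟩ := hdom v
    have hkD : ∀ s ∈ D, r k v ≤ r k s := fun s hs => hk s (Finset.mem_insert_of_mem hs)
    -- The minimum that `v` displaces in ranking `k` must remain minimal in another ranking `k'`;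
    -- hence `k` and `k'` are the identified pair.
    obtain ⟨k', hk'⟩ := hdom (m k)
    have hmk : m k' = m k := hr k' (le_antisymm (hmin k' _ (hmD k))
      (hk' _ (Finset.mem_insert_of_mem (hmD k'))))
    have hne : k' ≠ k := by
      rintro rfl
      have h1 := hk' v (Finset.mem_insert_self _ _)
      have h2 := hkD _ (hmD k')
      exact hvD (hr k' (le_antisymm h1 h2) ▸ hmD k')
    rw [← hmk] at hk'
    rcases hpair k' k hmk hne with ⟨rfl, rfl⟩ | ⟨rfl, rfl⟩
    · exact Or.inr (hforw _ _ hij.symm hmij.symm (fun a b h1 h2 => (hpair a b h1 h2).symm)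
        v hvD hdom hkD hk')
    · exact Or.inl (hforw _ _ hij hmij hpair v hvD hdom hkD hk')
  · rcases h with h | h
    · exact hback i j hij hmij v h
    · exact hback j i hij.symm hmij.symm v h

end Orders

/-! ### Parity count of doors and rooms. -/

section Parity

-- A room has one element more than a door, so the rooms containing `D` correspond to the elements
-- that can be added to it.
open Classical in
theorem card_rooms_eq {I V : Type*} [Fintype I] [Fintype V] [DecidableEq V] {r : I → V → ℕ} {D : Finset V} (hcard : D.card + 1 = Fintype.card I) :
    (Finset.univ.filter fun S : Finset V =>
      (S.card = Fintype.card I ∧ Dominant r S) ∧ D ⊆ S).card =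
    (Finset.univ.filter fun v => v ∉ D ∧ Dominant r (insert v D)).card := by
  symm
  refine Finset.card_bij (fun v _ => insert v D) ?_ ?_ ?_
  · intro v hv
    simp only [Finset.mem_filter, Finset.mem_univ, true_and] at hv ⊢
    exact ⟨⟨by rw [Finset.card_insert_of_notMem hv.1, hcard], hv.2⟩, Finset.subset_insert _ _⟩
  · intro v hv w hw h
    simp only [Finset.mem_filter, Finset.mem_univ, true_and] at hv hw
    have : v ∈ insert w D := h ▸ Finset.mem_insert_self v D
    exact (Finset.mem_insert.1 this).resolve_right hv.1
  · intro S hS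
    simp only [Finset.mem_filter, Finset.mem_univ, true_and] at hS
    obtain ⟨v, hvD, rfl⟩ := (Finset.exists_eq_insert_iff (s := D) (t := S)).2
      ⟨hS.2, by rw [hcard, hS.1.1]⟩
    exact ⟨v, by simpa using ⟨hvD, hS.1.2⟩, rfl⟩

variable {I V : Type*} [Fintype I] [DecidableEq I] [Fintype V] [DecidableEq V]

-- If the colours on `S` are exactly those other than `i₀`, one colour occurs twice, and the doors
-- arise by deleting either of its two bearers. Otherwise a non-colourful `S` misses a colour other
-- than `i₀` and has no doors.
open Classical in
theorem even_card_doors {S : Finset V} (hcard : S.card = Fintype.card I) (c : V → I) (i₀ : I)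
    (hS : S.image c ≠ Finset.univ) :
    Even ((Finset.univ.filter fun D : Finset V =>
      (D.card + 1 = Fintype.card I ∧ D.image c = Finset.univ.erase i₀) ∧ D ⊆ S).card) := by
  by_cases hex : S.image c = Finset.univ.erase i₀
  · have hpos : 0 < Fintype.card I := Fintype.card_pos_iff.2 ⟨i₀⟩
    obtain ⟨a, ha, b, hb, hab, hcab⟩ := Finset.exists_ne_map_eq_of_card_lt_of_maps_to
      (s := S) (t := Finset.univ.erase i₀) (f := c)
      (by rw [Finset.card_erase_of_mem (Finset.mem_univ _), Finset.card_univ]; omega)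
      (fun x hx => hex ▸ Finset.mem_image_of_mem c hx)
    have himg : ∀ a ∈ S, ∀ b ∈ S, a ≠ b → c a = c b →
        (S.erase a).image c = Finset.univ.erase i₀ := by
      intro a ha b hb hab hcab
      rw [← hex]
      refine Finset.Subset.antisymm (Finset.image_subset_image (Finset.erase_subset _ _)) ?_
      intro k hk
      obtain ⟨x, hx, rfl⟩ := Finset.mem_image.1 hk
      by_cases hxa : x = a
      · exact Finset.mem_image.2 ⟨b, Finset.mem_erase.2 ⟨hab.symm, hb⟩, by rw [hxa, hcab]⟩
      · exact Finset.mem_image_of_mem c (Finset.mem_erase.2 ⟨hxa, hx⟩)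
    have heq : (Finset.univ.filter fun D : Finset V =>
        (D.card + 1 = Fintype.card I ∧ D.image c = Finset.univ.erase i₀) ∧ D ⊆ S) =
        {S.erase a, S.erase b} := by
      ext D
      simp only [Finset.mem_filter, Finset.mem_univ, true_and, Finset.mem_insert,
        Finset.mem_singleton]
      constructor
      · rintro ⟨⟨hDc, hDi⟩, hDS⟩
        obtain ⟨v, hvD, rfl⟩ := (Finset.exists_eq_insert_iff (s := D) (t := S)).2
          ⟨hDS, by rw [hDc, hcard]⟩
        have hinj : Set.InjOn c (D : Set V) := by
          rw [← Finset.card_image_iff, hDi, Finset.card_erase_of_mem (Finset.mem_univ _),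
            Finset.card_univ]
          omega
        have : v = a ∨ v = b := by
          by_contra! h
          exact hab (hinj ((Finset.mem_insert.1 ha).resolve_left h.1.symm)
            ((Finset.mem_insert.1 hb).resolve_left h.2.symm) hcab)
        rcases this with rfl | rfl
        · left; rw [Finset.erase_insert hvD]
        · right; rw [Finset.erase_insert hvD]
      · rintro (rfl | rfl)
        · exact ⟨⟨by rw [Finset.card_erase_add_one ha, hcard], himg a ha b hb hab hcab⟩,
            Finset.erase_subset _ _⟩
        · exact ⟨⟨by rw [Finset.card_erase_add_one hb, hcard], himg b hb a ha hab.symm hcab.symm⟩,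
            Finset.erase_subset _ _⟩
    rw [heq, Finset.card_pair]
    · exact even_two
    · intro h
      have : a ∈ S.erase b := Finset.mem_erase.2 ⟨hab, ha⟩
      rw [← h] at this
      exact (Finset.mem_erase.1 this).1 rfl
  · rw [Finset.filter_false_of_mem]
    · simp
    · rintro D - ⟨⟨-, hDi⟩, hDS⟩
      have hsub : Finset.univ.erase i₀ ⊆ S.image c := hDi ▸ Finset.image_subset_image hDS
      by_cases hi : i₀ ∈ S.image c
      · apply hS
        rw [Finset.eq_univ_iff_forall]
        intro k
        by_cases hk : k = i₀
        · rwa [hk]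
        · exact hsub (by simpa using hk)
      · apply hex
        refine Finset.Subset.antisymm (fun k hk => ?_) hsub
        refine Finset.mem_erase.2 ⟨?_, Finset.mem_univ _⟩
        rintro rfl
        exact hi hk

/-- The parity argument: if exactly one door of type `i₀` is a boundary door, then there is a
colourful room. -/
theorem exists_colourful {r : I → V → ℕ} (hr : ∀ i, Function.Injective (r i)) (c : V → I) (i₀ : I)
    (hI : 2 ≤ Fintype.card I) {D₀ : Finset V} (hD₀ : Dominant r D₀)
    (hD₀card : D₀.card + 1 = Fintype.card I) (hD₀c : D₀.image c = Finset.univ.erase i₀)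
    (hD₀deg : ∃! v, v ∉ D₀ ∧ Dominant r (insert v D₀))
    (hdeg : ∀ D : Finset V, D.card + 1 = Fintype.card I → D ≠ D₀ →
      D.image c = Finset.univ.erase i₀ → ∀ i j, i ≠ j →
      ∀ d ∈ D, (∀ s ∈ D, r i d ≤ r i s) → (∀ s ∈ D, r j d ≤ r j s) →
      ∃ t, ∀ l, l ≠ i → ∃ s ∈ D, r l s < r l t) :
    ∃ S : Finset V, Dominant r S ∧ S.image c = Finset.univ := by
  classical
  by_contra! hno
  set R : Finset (Finset V) := Finset.univ.filter fun S =>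
    S.card = Fintype.card I ∧ Dominant r S with hR
  set Dr : Finset (Finset V) := Finset.univ.filter fun D =>
    (D.card + 1 = Fintype.card I ∧ D.image c = Finset.univ.erase i₀) ∧ Dominant r D with hDr
  -- Incidences are counted twice: each room has an even number of doors, each door except `D₀` lies
  -- in two rooms, and `D₀` lies in one.
  have hcount := Finset.sum_card_bipartiteAbove_eq_sum_card_bipartiteBelow
    (s := Dr) (t := R) (fun D S => D ⊆ S)
  have heven : Even (∑ S ∈ R, (Dr.bipartiteBelow (fun D S => D ⊆ S) S).card) := by
    refine Finset.even_sum _ fun S hS => ?_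
    simp only [hR, Finset.mem_filter, Finset.mem_univ, true_and] at hS
    have := even_card_doors hS.1 c i₀ (hno S hS.2)
    have heq : Dr.bipartiteBelow (fun D S => D ⊆ S) S = Finset.univ.filter fun D : Finset V =>
        (D.card + 1 = Fintype.card I ∧ D.image c = Finset.univ.erase i₀) ∧ D ⊆ S := by
      ext D
      simp only [Finset.bipartiteBelow, hDr, Finset.mem_filter, Finset.mem_univ, true_and]
      exact ⟨fun h => ⟨h.1.1, h.2⟩, fun h => ⟨⟨h.1, hS.2.mono h.2⟩, h.2⟩⟩
    rwa [heq]
  have habove : ∀ D ∈ Dr, (R.bipartiteAbove (fun D S => D ⊆ S) D).card =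
      (Finset.univ.filter fun v => v ∉ D ∧ Dominant r (insert v D)).card := by
    intro D hD
    simp only [hDr, Finset.mem_filter, Finset.mem_univ, true_and] at hD
    rw [← card_rooms_eq hD.1.1]
    congr 1
    ext S
    simp [Finset.bipartiteAbove, hR]
  have hD₀mem : D₀ ∈ Dr := by
    simp only [hDr, Finset.mem_filter, Finset.mem_univ, true_and]
    exact ⟨⟨hD₀card, hD₀c⟩, hD₀⟩
  rw [← hcount, ← Finset.add_sum_erase _ _ hD₀mem] at heven
  have hodd : (R.bipartiteAbove (fun D S => D ⊆ S) D₀).card = 1 := by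
    rw [habove D₀ hD₀mem, Finset.card_eq_one]
    obtain ⟨v, hv, huniq⟩ := hD₀deg
    refine ⟨v, ?_⟩
    ext w
    simp only [Finset.mem_filter, Finset.mem_univ, true_and, Finset.mem_singleton]
    exact ⟨fun h => huniq w h, fun h => h ▸ hv⟩
  have hrest : Even (∑ D ∈ Dr.erase D₀, (R.bipartiteAbove (fun D S => D ⊆ S) D).card) := by
    refine Finset.even_sum _ fun D hD => ?_
    obtain ⟨hne, hD⟩ := Finset.mem_erase.1 hD
    rw [habove D hD]
    simp only [hDr, Finset.mem_filter, Finset.mem_univ, true_and] at hD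
    have hDne : D.Nonempty := Finset.card_pos.1 (by omega)
    choose m hmD hmin using fun i => Finset.exists_min_image D (r i) hDne
    obtain ⟨i, j, hij, hmij, hiff⟩ := exists_pair_completions hr hD.2 hD.1.1 hmD hmin
    have hcompl : ∀ i j, i ≠ j → m i = m j → ∃ v, IsCompletion r m i v := by
      intro i j hij hmij
      apply exists_isCompletion
      obtain ⟨t, ht⟩ := hdeg D hD.1.1 hne hD.1.2 i j hij (m i) (hmD i) (hmin i)
        (hmij ▸ hmin j)
      refine ⟨t, fun l hl => ?_⟩
      obtain ⟨s, hs, hlt⟩ := ht l hl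
      exact (hmin l s hs).trans_lt hlt
    obtain ⟨v, hv⟩ := hcompl i j hij hmij
    obtain ⟨w, hw⟩ := hcompl j i hij.symm hmij.symm
    -- A common completion would lie strictly above `m k` in every ranking `k`, against dominance of
    -- `insert v D`.
    have hvw : v ≠ w := by
      rintro rfl
      obtain ⟨-, hdom⟩ := (hiff v).2 (Or.inl hv)
      obtain ⟨k, hk⟩ := hdom v
      have hk' := hk _ (Finset.mem_insert_of_mem (hmD k))
      by_cases hki : k = i
      · exact absurd hk' (not_le.2 (hw.1 k (hki ▸ hij)))
      · exact absurd hk' (not_le.2 (hv.1 k hki))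
    have : (Finset.univ.filter fun v => v ∉ D ∧ Dominant r (insert v D)) = {v, w} := by
      ext x
      rw [Finset.mem_filter, hiff]
      simp only [Finset.mem_univ, true_and, Finset.mem_insert, Finset.mem_singleton]
      constructor
      · rintro (h | h)
        · exact Or.inl (h.unique hr hv)
        · exact Or.inr (h.unique hr hw)
      · rintro (rfl | rfl)
        · exact Or.inl hv
        · exact Or.inr hw
    rw [this, Finset.card_pair hvw]
    exact even_two
  rw [hodd, Nat.even_add] at heven
  exact absurd (heven.2 hrest) (by decide)

end Parity


/-! ### Scarf's lemma by means of slack elements. -/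

section Slack

variable {I T : Type*} [DecidableEq I]

/-- Extension of rankings on `T` to `T ⊕ I`: the slack element `i` is lowest in ranking `i` and
lies above `T` in all other rankings. -/
def slackRank (ρ : I → T → ℕ) (B : ℕ) (e : I → ℕ) (i : I) : T ⊕ I → ℕ
  | .inl x => ρ i x + 1
  | .inr j => if j = i then 0 else B + 2 + e j

theorem slackRank_injective {ρ : I → T → ℕ} (hρ : ∀ i, Function.Injective (ρ i)) {B : ℕ}
    (hB : ∀ i x, ρ i x ≤ B) {e : I → ℕ} (he : Function.Injective e) (i : I) :
    Function.Injective (slackRank ρ B e i) := by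
  rintro (x | j) (y | k) h
  · simp only [slackRank, add_left_inj] at h
    rw [hρ i h]
  · simp only [slackRank] at h
    have := hB i x
    split_ifs at h; all_goals omega
  · simp only [slackRank] at h
    have := hB i y
    split_ifs at h; all_goals omega
  · simp only [slackRank] at h
    split_ifs at h with h1 h2 h2
    · rw [h1, h2]
    · omega
    · omega
    · rw [he (by omega : e j = e k)]

/-- Scarf's lemma in the form of Petri and Voorneveld. -/
theorem exists_colourful_dominant [Fintype I] [Fintype T] [DecidableEq T] [Nonempty T] {ρ : I → T → ℕ}
    (hρ : ∀ i, Function.Injective (ρ i)) (c : T → I) (hI : 2 ≤ Fintype.card I) :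
    ∃ (σ : Finset T) (C : Finset I), σ.Nonempty ∧
      (∀ t, ∃ i ∈ C, ∀ s ∈ σ, ρ i t ≤ ρ i s) ∧ ∀ i ∈ C, ∃ s ∈ σ, c s = i := by
  classical
  obtain ⟨B, hB'⟩ := (Set.finite_range fun q : I × T => ρ q.1 q.2).bddAbove
  have hB : ∀ i x, ρ i x ≤ B := fun i x => hB' ⟨(i, x), rfl⟩
  let e : I → ℕ := fun i => Fintype.equivFin I i
  have he : Function.Injective e := fun i j h => (Fintype.equivFin I).injective (Fin.ext h)
  set r := slackRank ρ B e with hrdef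
  have hr : ∀ i, Function.Injective (r i) := slackRank_injective hρ hB he
  have r_inl : ∀ i x, r i (.inl x) = ρ i x + 1 := fun _ _ => rfl
  have r_self : ∀ i, r i (.inr i) = 0 := fun i => by simp [hrdef, slackRank]
  have r_ne : ∀ i j, j ≠ i → r i (.inr j) = B + 2 + e j := fun i j h => by
    simp [hrdef, slackRank, h]
  let col : T ⊕ I → I := Sum.elim c id
  have hne : (Finset.univ : Finset I).Nonempty := by
    rw [← Finset.card_pos, Finset.card_univ]; omega
  obtain ⟨i₀, -⟩ := hne
  obtain ⟨t₀⟩ := ‹Nonempty T›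
  -- The boundary door consists of all slack elements but `i₀`. Its only completion is the
  -- `i₀`-largest element of `T`: adding the last slack element would leave a rank `0` in every
  -- ranking, below all of `T`.
  set D₀ : Finset (T ⊕ I) := (Finset.univ.erase i₀).image Sum.inr with hD₀def
  have hD₀mem : ∀ l, l ≠ i₀ → (Sum.inr l : T ⊕ I) ∈ D₀ := fun l hl =>
    Finset.mem_image_of_mem _ (by simpa using hl)
  have hD₀card : D₀.card + 1 = Fintype.card I := by
    rw [hD₀def, Finset.card_image_of_injective _ Sum.inr_injective,
      Finset.card_erase_add_one (Finset.mem_univ _), Finset.card_univ]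
  obtain ⟨l₀, hl₀, hl₀min⟩ : ∃ l₀, l₀ ≠ i₀ ∧ ∀ l, l ≠ i₀ → e l₀ ≤ e l := by
    obtain ⟨l₀, h1, h2⟩ := Finset.exists_min_image (Finset.univ.erase i₀) e (by
      rw [← Finset.card_pos, Finset.card_erase_of_mem (Finset.mem_univ _), Finset.card_univ]; omega)
    exact ⟨l₀, by simpa using h1, fun l hl => h2 l (by simpa using hl)⟩
  have hD₀min : ∀ s ∈ D₀, r i₀ (.inr l₀) ≤ r i₀ s := by
    intro s hs
    obtain ⟨l, hl, rfl⟩ := Finset.mem_image.1 hs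
    have hl' : l ≠ i₀ := by simpa using hl
    rw [r_ne _ _ hl', r_ne _ _ hl₀]
    have := hl₀min l hl'
    omega
  have hD₀dom : Dominant r D₀ := by
    rintro (x | j)
    · refine ⟨i₀, fun s hs => le_trans ?_ (hD₀min s hs)⟩
      rw [r_inl, r_ne _ _ hl₀]
      have := hB i₀ x
      omega
    · exact ⟨j, fun s _ => by rw [r_self]; exact Nat.zero_le _⟩
  obtain ⟨S, hSdom, hScol⟩ := exists_colourful hr col i₀ hI hD₀dom hD₀card
    (by rw [hD₀def, Finset.image_image]; exact Finset.image_id)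
    (by
      obtain ⟨x₀, -, hx₀⟩ := Finset.exists_max_image (Finset.univ : Finset T) (ρ i₀) ⟨t₀, by simp⟩
      have hnot : ∀ x : T, (Sum.inl x : T ⊕ I) ∉ D₀ := by simp [hD₀def]
      have hx₀dom : Dominant r (insert (.inl x₀) D₀) := by
        rintro (x | j)
        · refine ⟨i₀, fun s hs => ?_⟩
          rcases Finset.mem_insert.1 hs with rfl | hs
          · rw [r_inl, r_inl]
            have := hx₀ x (Finset.mem_univ _)
            omega
          · refine le_trans ?_ (hD₀min s hs)
            rw [r_inl, r_ne _ _ hl₀]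
            have := hB i₀ x
            omega
        · exact ⟨j, fun s _ => by rw [r_self]; exact Nat.zero_le _⟩
      refine ⟨.inl x₀, ⟨hnot _, hx₀dom⟩, ?_⟩
      rintro (x | j) ⟨hvD, hdom⟩
      · obtain ⟨i, hi⟩ := hdom (.inl x₀)
        by_cases hii : i = i₀
        · subst hii
          have := hi _ (Finset.mem_insert_self _ _)
          rw [r_inl, r_inl] at this
          have h2 := hx₀ x (Finset.mem_univ _)
          rw [hρ i (by omega : ρ i x = ρ i x₀)]
        · have := hi _ (Finset.mem_insert_of_mem (hD₀mem i hii))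
          rw [r_self, r_inl] at this
          omega
      · exfalso
        have hj : j = i₀ := by
          by_contra hj
          exact hvD (hD₀mem j hj)
        subst hj
        obtain ⟨i, hi⟩ := hdom (.inl t₀)
        have h1 : r i (.inl t₀) ≤ r i (.inr i) := by
          by_cases hij : i = j
          · subst hij
            exact hi _ (Finset.mem_insert_self _ _)
          · exact hi _ (Finset.mem_insert_of_mem (hD₀mem i hij))
        rw [r_self, r_inl] at h1
        omega)
    (by
      intro D hDcard hDne hDcol i j hij d hd hdi hdj
      obtain ⟨x, hx⟩ : ∃ x : T, (.inl x : T ⊕ I) ∈ D := by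
        by_contra! hnone
        apply hDne
        refine Finset.eq_of_subset_of_card_le (fun s hs => ?_) (by omega)
        rcases s with x | l
        · exact absurd hs (hnone x)
        · refine hD₀mem l ?_
          have : col (.inr l) ∈ D.image col := Finset.mem_image_of_mem _ hs
          rw [hDcol] at this
          exact (Finset.mem_erase.1 this).1
      -- A door other than `D₀` contains some `x` from `T`, and slack `i` lies above `x` in every
      -- ranking but the `i`-th.
      refine ⟨.inr i, fun l hl => ⟨.inl x, hx, ?_⟩⟩
      rw [r_inl, r_ne _ _ hl.symm]
      have := hB l x
      omega)
  set σ : Finset T := Finset.univ.filter fun x => (.inl x : T ⊕ I) ∈ S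
  -- An absent slack element leaves its colour to be supplied by `T`; a present one has rank `0` in
  -- its own ranking, which therefore cannot witness dominance over `T`.
  set C : Finset I := Finset.univ.filter fun i => (.inr i : T ⊕ I) ∉ S
  have hdom : ∀ t, ∃ i ∈ C, ∀ s ∈ σ, ρ i t ≤ ρ i s := by
    intro t
    obtain ⟨i, hi⟩ := hSdom (.inl t)
    refine ⟨i, ?_, fun s hs => ?_⟩
    · simp only [C, Finset.mem_filter, Finset.mem_univ, true_and]
      intro hiS
      have := hi _ hiS
      rw [r_self, r_inl] at this
      omega
    · have := hi (.inl s) (by simpa [σ] using hs)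
      rw [r_inl, r_inl] at this
      omega
  have hcol : ∀ i ∈ C, ∃ s ∈ σ, c s = i := by
    intro i hi
    have : i ∈ S.image col := hScol ▸ Finset.mem_univ i
    obtain ⟨s, hs, hsi⟩ := Finset.mem_image.1 this
    rcases s with x | l
    · exact ⟨x, by simpa [σ] using hs, hsi⟩
    · have hli : l = i := hsi
      subst hli
      simp only [C, Finset.mem_filter, Finset.mem_univ, true_and] at hi
      exact absurd hs hi
  obtain ⟨i, hi, -⟩ := hdom t₀
  obtain ⟨s, hs, -⟩ := hcol i hi
  exact ⟨σ, C, ⟨s, hs⟩, hdom, hcol⟩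

end Slack


/-! ### Scarf's lemma on the integer grid of a simplex. -/

section Grid

variable {I : Type*} [Fintype I] [DecidableEq I]

/-- Any colouring of the grid points of a simplex has a grid point each of whose coordinates is
small or nearly shared with a grid point of the corresponding colour. -/
theorem exists_grid_point (hI : 2 ≤ Fintype.card I) (N : ℕ) (c : (I → ℕ) → I) :
    ∃ p : I → ℕ, ∑ i, p i = N ∧ ∀ i, p i ≤ Fintype.card I ∨
      ∃ s : I → ℕ, ∑ j, s j = N ∧ c s = i ∧
        ∀ j, p j ≤ s j + Fintype.card I ∧ s j ≤ p j + Fintype.card I := by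
  classical
  set n := Fintype.card I
  let T := {x : I → ℕ // x ∈ Finset.piAntidiag Finset.univ N}
  let _ : Fintype T := Finset.Subtype.fintype (Finset.piAntidiag Finset.univ N)
  have hT : ∀ x : T, ∑ i, x.1 i = N := fun x => (Finset.mem_piAntidiag.1 x.2).1
  have mkT : ∀ x : I → ℕ, ∑ i, x i = N → x ∈ Finset.piAntidiag Finset.univ N := fun x hx =>
    Finset.mem_piAntidiag.2 ⟨hx, fun i _ => Finset.mem_univ i⟩
  obtain ⟨i₀⟩ : Nonempty I := Fintype.card_pos_iff.1 (by omega)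
  have hTne : Nonempty T := ⟨⟨Pi.single i₀ N, mkT _ (by simp)⟩⟩
  set M := Fintype.card T
  let enc : T → Fin M := Fintype.equivFin T
  -- Order by the `i`-th coordinate, with ties broken by the enumeration `enc`.
  let ρ : I → T → ℕ := fun i x => x.1 i * M + enc x
  have hρ : ∀ i, Function.Injective (ρ i) := by
    intro i x y h
    have h2 := congrArg (· % M) h
    simp only [ρ, Nat.mul_add_mod_self_right, Nat.mod_eq_of_lt (enc x).2,
      Nat.mod_eq_of_lt (enc y).2] at h2
    exact (Fintype.equivFin T).injective (Fin.ext h2)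
  have hρle : ∀ i (x y : T), ρ i x ≤ ρ i y → x.1 i ≤ y.1 i := by
    intro i x y h
    by_contra! hlt
    have h1 : (y.1 i + 1) * M ≤ x.1 i * M := Nat.mul_le_mul_right _ hlt
    have h2 := (enc y).2
    simp only [ρ] at h
    rw [add_mul] at h1
    omega
  obtain ⟨σ, C, hσ, hdom, hcol⟩ := exists_colourful_dominant hρ (fun x : T => c x.1) hI
  choose m hmσ hmin using fun i => Finset.exists_min_image σ (fun x : T => x.1 i) hσ
  -- Otherwise the total `N` suffices for a grid point exceeding every minimum indexed by `C`,
  -- against dominance. Since the coordinates of a point of `σ` also sum to `N`, each has slack less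
  -- than `n`, so points of `σ` are close together.
  have hsum : N < ∑ i ∈ C, (m i).1 i + n := by
    have hC : C.card ≤ n := Finset.card_le_univ C
    suffices N < ∑ i ∈ C, ((m i).1 i + 1) by
      rw [Finset.sum_add_distrib, Finset.sum_const, smul_eq_mul, mul_one] at this
      omega
    by_contra! hle
    obtain ⟨i₁, hi₁, -⟩ := hdom (m i₀)
    set g : I → ℕ := fun i => if i ∈ C then (m i).1 i + 1 else 0
    have hg : ∑ i, g i = ∑ i ∈ C, ((m i).1 i + 1) := by
      simp [g, Finset.sum_ite_mem]
    set t : I → ℕ := fun i => g i + (Pi.single i₁ (N - ∑ i, g i) : I → ℕ) i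
    have ht : ∑ i, t i = N := by
      simp only [t, Finset.sum_add_distrib, Finset.sum_pi_single', Finset.mem_univ, if_true]
      omega
    obtain ⟨i, hi, hit⟩ := hdom ⟨t, mkT t ht⟩
    have h1 := hρle i _ _ (hit (m i) (hmσ i))
    have h2 : (m i).1 i + 1 ≤ t i := by
      simp only [t, g, if_pos hi]
      omega
    exact absurd (h2.trans h1) (by omega)
  have hout : ∀ s ∈ σ, ∀ j, j ∉ C → s.1 j < n := by
    intro s hs j hj
    have h1 : ∑ i ∈ insert j C, s.1 i ≤ N :=
      (Finset.sum_le_univ_sum_of_nonneg fun _ => Nat.zero_le _).trans_eq (hT s)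
    rw [Finset.sum_insert hj] at h1
    have h2 : ∑ i ∈ C, (m i).1 i ≤ ∑ i ∈ C, s.1 i := Finset.sum_le_sum fun i _ => hmin i s hs
    omega
  have hin : ∀ s ∈ σ, ∀ j, j ∈ C → s.1 j < (m j).1 j + n := by
    intro s hs j hj
    have h1 : ∑ i ∈ C, s.1 i ≤ N :=
      (Finset.sum_le_univ_sum_of_nonneg fun _ => Nat.zero_le _).trans_eq (hT s)
    rw [← Finset.add_sum_erase _ _ hj] at h1 hsum
    have h2 : ∑ i ∈ C.erase j, (m i).1 i ≤ ∑ i ∈ C.erase j, s.1 i :=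
      Finset.sum_le_sum fun i _ => hmin i s hs
    omega
  obtain ⟨p, hp⟩ := hσ
  refine ⟨p.1, hT p, fun i => ?_⟩
  by_cases hi : i ∈ C
  · obtain ⟨s, hs, hsi⟩ := hcol i hi
    refine Or.inr ⟨s.1, hT s, hsi, fun j => ?_⟩
    by_cases hj : j ∈ C
    · have h1 := hin p hp j hj
      have h2 := hin s hs j hj
      have h3 : (m j).1 j ≤ p.1 j := hmin j p hp
      have h4 : (m j).1 j ≤ s.1 j := hmin j s hs
      omega
    · have h1 := hout p hp j hj
      have h2 := hout s hs j hj
      omega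
  · exact Or.inl (hout p hp i hi).le

end Grid

/-! ### Brouwer's theorem on the simplex. -/

/-- Approximate form of Brouwer's theorem on the standard simplex. -/
theorem exists_approx_fixed_stdSimplex {I : Type*} [Fintype I] [Nonempty I]
    {f : (I → ℝ) → I → ℝ} (hf : ContinuousOn f (stdSimplex ℝ I))
    (hmaps : Set.MapsTo f (stdSimplex ℝ I) (stdSimplex ℝ I)) {ε : ℝ} (hε : 0 < ε) :
    ∃ x ∈ stdSimplex ℝ I, ∀ i, x i ≤ f x i + ε := by
  classical
  rcases lt_or_ge (Fintype.card I) 2 with hI | hI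
  · have hsub : Subsingleton I := Fintype.card_le_one_iff_subsingleton.1 (by omega)
    obtain ⟨i₀⟩ := ‹Nonempty I›
    refine ⟨Pi.single i₀ 1, single_mem_stdSimplex ℝ i₀, fun i => ?_⟩
    have h1 := (hmaps (single_mem_stdSimplex ℝ i₀)).2
    rw [Fintype.sum_subsingleton _ i] at h1
    rw [h1, Subsingleton.elim i i₀, Pi.single_eq_same]
    linarith
  have huc := (isCompact_stdSimplex ℝ I).uniformContinuousOn_of_continuous hf
  obtain ⟨δ, hδ, hfδ⟩ := Metric.uniformContinuousOn_iff.1 huc (ε / 2) (by positivity)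
  set n := Fintype.card I
  obtain ⟨N, hN⟩ := exists_nat_gt ((n : ℝ) / min δ (ε / 2))
  have hmin : 0 < min δ (ε / 2) := lt_min hδ (by positivity)
  have hN0 : (0 : ℝ) < N := lt_of_le_of_lt (by positivity) hN
  have hnN : (n : ℝ) / N < min δ (ε / 2) := by
    rw [div_lt_iff₀ hmin] at hN
    rw [div_lt_iff₀ hN0, mul_comm]
    exact hN
  let pt : (I → ℕ) → I → ℝ := fun s i => (s i : ℝ) / N
  have hpt : ∀ s : I → ℕ, ∑ i, s i = N → pt s ∈ stdSimplex ℝ I := by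
    intro s hs
    refine ⟨fun i => by positivity, ?_⟩
    simp only [pt]
    rw [← Finset.sum_div, ← Nat.cast_sum, hs, div_self hN0.ne']
  -- A point and its image have equal coordinate sums, so some coordinate does not decrease; it
  -- serves as the colour.
  have hex : ∀ s : I → ℕ, ∃ i, ∑ i, s i = N → pt s i ≤ f (pt s) i := by
    intro s
    by_cases hs : ∑ i, s i = N
    · obtain ⟨i, -, hi⟩ := Finset.exists_le_of_sum_le (s := Finset.univ) (f := pt s)
        (g := f (pt s)) Finset.univ_nonempty
        (by rw [(hpt s hs).2, (hmaps (hpt s hs)).2])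
      exact ⟨i, fun _ => hi⟩
    · exact ⟨Classical.arbitrary I, fun h => absurd h hs⟩
  choose c hc using hex
  obtain ⟨p, hp, hpi⟩ := exists_grid_point hI N c
  refine ⟨pt p, hpt p hp, fun i => ?_⟩
  rcases hpi i with h | ⟨s, hs, hsi, hclose⟩
  · have h1 : pt p i ≤ n / N := by
      simp only [pt]
      gcongr
    have h2 := (hmaps (hpt p hp)).1 i
    have h3 := min_le_right δ (ε / 2)
    linarith
  · have hdist : ∀ j, |pt p j - pt s j| ≤ n / N := by
      intro j
      simp only [pt]
      rw [← sub_div, abs_div, abs_of_pos hN0]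
      gcongr
      rw [abs_le]
      have h1 : (p j : ℝ) ≤ s j + n := by exact_mod_cast (hclose j).1
      have h2 : (s j : ℝ) ≤ p j + n := by exact_mod_cast (hclose j).2
      constructor <;> linarith
    have h1 : dist (pt p) (pt s) < δ := by
      refine lt_of_le_of_lt ?_ (hnN.trans_le (min_le_left _ _))
      rw [dist_pi_le_iff (by positivity)]
      exact fun j => hdist j
    have h2 := (dist_le_pi_dist (f (pt p)) (f (pt s)) i).trans_lt
      (hfδ _ (hpt p hp) _ (hpt s hs) h1)
    rw [Real.dist_eq, abs_lt] at h2
    have h3 := hsi ▸ hc s hs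
    have h4 := (abs_le.1 (hdist i)).2
    have h5 := min_le_right δ (ε / 2)
    linarith

/-- **Brouwer's fixed point theorem** for the standard simplex. -/
theorem exists_fixed_stdSimplex {I : Type*} [Fintype I] [Nonempty I]
    {f : (I → ℝ) → I → ℝ} (hf : ContinuousOn f (stdSimplex ℝ I))
    (hmaps : Set.MapsTo f (stdSimplex ℝ I) (stdSimplex ℝ I)) :
    ∃ x ∈ stdSimplex ℝ I, f x = x := by
  classical
  have hcont : ∀ i, ContinuousOn (fun x => x i - f x i) (stdSimplex ℝ I) := fun i =>
    (continuous_apply i).continuousOn.sub ((continuous_apply i).comp_continuousOn hf)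
  have hcont' : ContinuousOn (fun x => Finset.univ.sup' Finset.univ_nonempty
      fun i => x i - f x i) (stdSimplex ℝ I) :=
    ContinuousOn.finset_sup'_apply _ fun i _ => hcont i
  obtain ⟨x, hx, hmin⟩ := (isCompact_stdSimplex ℝ I).exists_isMinOn
    ⟨_, single_mem_stdSimplex ℝ (Classical.arbitrary I)⟩ hcont'
  refine ⟨x, hx, ?_⟩
  -- The minimum of `max_i (x i - f x i)` is at most every `ε > 0`. Equality of the sums then turns
  -- `x ≤ f x` into `f x = x`.
  have hle : ∀ i, x i ≤ f x i := by
    intro i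
    refine le_of_forall_pos_le_add fun ε hε => ?_
    obtain ⟨y, hy, hyi⟩ := exists_approx_fixed_stdSimplex hf hmaps hε
    have h1 : (Finset.univ.sup' Finset.univ_nonempty fun i => y i - f y i) ≤ ε :=
      Finset.sup'_le _ _ fun i _ => by linarith [hyi i]
    have h2 := Finset.le_sup' (fun i => x i - f x i) (Finset.mem_univ i)
    have h3 := hmin hy
    simp only [Set.mem_ofPred_eq] at h3
    linarith
  have hsum : ∑ i, x i = ∑ i, f x i := by rw [hx.2, (hmaps hx).2]
  funext i
  exact (((Finset.sum_eq_sum_iff_of_le fun i _ => hle i).1 hsum) i (Finset.mem_univ i)).symm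

end Scarf

namespace SkewVNJ

/-! ### Approximate fixed points of multivalued maps. -/

section ApproxFixed

variable {E : Type*} [NormedAddCommGroup E] [NormedSpace ℝ E]

/-- `T` is Lipschitz on `C` with constant `k`, in the pointwise form for multivalued maps. -/
def MultiLipschitzOn (k : ℝ) (T : E → Set E) (C : Set E) : Prop :=
  ∀ x ∈ C, ∀ y ∈ C, ∀ u ∈ T x, ∃ v ∈ T y, ‖u - v‖ ≤ k * ‖x - y‖

/-- Approximate Kakutani theorem: a convex-valued Lipschitz map whose values meet the compact convex
set `K` has approximate fixed points in `K`. -/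
theorem exists_approx_fixed_of_isCompact {K : Set E} (hK : IsCompact K) (hKc : Convex ℝ K)
    (hKne : K.Nonempty) {F : E → Set E} {k : ℝ} (hk : 0 ≤ k) (hF : MultiLipschitzOn k F K)
    (hFc : ∀ x ∈ K, Convex ℝ (F x)) (hFK : ∀ x ∈ K, (F x ∩ K).Nonempty) {ε : ℝ} (hε : 0 < ε) :
    ∃ x ∈ K, ∃ v ∈ F x, ‖x - v‖ ≤ ε := by
  classical
  set δ := ε / (k + 1)
  have hδ : 0 < δ := by positivity
  obtain ⟨t, htK, htfin, htcov⟩ := hK.finite_cover_balls hδ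
  have : Fintype t := htfin.fintype
  have hcov : ∀ x ∈ K, ∃ i : t, ‖x - i‖ < δ := by
    intro x hx
    obtain ⟨i, hi, hxi⟩ := Set.mem_iUnion₂.1 (htcov hx)
    exact ⟨⟨i, hi⟩, by rwa [← dist_eq_norm]⟩
  have : Nonempty t := let ⟨x, hx⟩ := hKne; let ⟨i, _⟩ := hcov x hx; ⟨i⟩
  choose y hy using fun i : t => hFK i (htK i.2)
  let θ : t → E → ℝ := fun i x => max 0 (δ - ‖x - i‖)
  have hθ0 : ∀ i x, 0 ≤ θ i x := fun i x => le_max_left _ _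
  have hθc : ∀ i, Continuous (θ i) := fun i => by fun_prop
  have hs : ∀ x ∈ K, 0 < ∑ i, θ i x := by
    intro x hx
    obtain ⟨i, hi⟩ := hcov x hx
    exact Finset.sum_pos' (fun i _ => hθ0 i x)
      ⟨i, Finset.mem_univ i, lt_max_of_lt_right (sub_pos.2 hi)⟩
  let pt : (t → ℝ) → E := fun w => ∑ i, w i • y i
  have hpt : ∀ w ∈ stdSimplex ℝ t, pt w ∈ K := fun w hw =>
    hKc.sum_mem (fun i _ => hw.1 i) hw.2 fun i _ => (hy i).2
  have hptc : Continuous pt := by fun_prop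
  -- Weights `w` are sent to the partition of unity evaluated at `∑ w i • y i`. At a fixed point
  -- only net points within `δ` of `pt w` carry weight, so each such `y i` is near `F (pt w)`, and
  -- convexity averages the errors.
  let f : (t → ℝ) → t → ℝ := fun w i => θ i (pt w) / ∑ j, θ j (pt w)
  obtain ⟨w, hw, hfix⟩ := Scarf.exists_fixed_stdSimplex (f := f)
    (continuousOn_pi.2 fun i => ContinuousOn.div ((hθc i).comp hptc).continuousOn
      (continuous_finsetSum _ fun j _ => (hθc j).comp hptc).continuousOn
      fun w hw => (hs _ (hpt w hw)).ne')
    (fun w hw => ⟨fun i => div_nonneg (hθ0 _ _) (hs _ (hpt w hw)).le, by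
      simp only [f]
      rw [← Finset.sum_div, div_self (hs _ (hpt w hw)).ne']⟩)
  have hx := hpt w hw
  have hv : ∀ i : t, ∃ v ∈ F (pt w), w i ≠ 0 → ‖y i - v‖ ≤ ε := by
    intro i
    by_cases hwi : w i = 0
    · obtain ⟨v, hv⟩ := hFK _ hx
      exact ⟨v, hv.1, fun h => absurd hwi h⟩
    · obtain ⟨v, hv, hle⟩ := hF i (htK i.2) _ hx (y i) (hy i).1
      refine ⟨v, hv, fun _ => hle.trans ?_⟩
      have hpos : 0 < δ - ‖pt w - i‖ := by
        by_contra! hle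
        apply hwi
        rw [← hfix]
        simp only [f, θ]
        rw [max_eq_left hle, zero_div]
      rw [norm_sub_rev]
      calc k * ‖pt w - i‖ ≤ (k + 1) * δ := by gcongr <;> linarith
        _ = ε := by simp only [δ]; field_simp
  choose v hvF hvy using hv
  refine ⟨pt w, hx, ∑ i, w i • v i, (hFc _ hx).sum_mem (fun i _ => hw.1 i) hw.2
    fun i _ => hvF i, ?_⟩
  simp only [pt]
  rw [← Finset.sum_sub_distrib]
  calc ‖∑ i, (w i • y i - w i • v i)‖ ≤ ∑ i, w i * ε := by
        refine norm_sum_le_of_le _ fun i _ => ?_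
        rw [← smul_sub, norm_smul, Real.norm_of_nonneg (hw.1 i)]
        by_cases hwi : w i = 0
        · simp [hwi]
        · exact mul_le_mul_of_nonneg_left (hvy i hwi) (hw.1 i)
    _ = ε := by rw [← Finset.sum_mul, hw.2, one_mul]

open scoped Pointwise in
/-- A multivalued contraction of `C` whose values meet the closed convex subset `A` has a compact
convex subset of `A` that its values meet. -/
theorem exists_isCompact_meets [CompleteSpace E] {C A : Set E} (hC : Convex ℝ C)
    (hCb : Bornology.IsBounded C) (hA : IsClosed A) (hAc : Convex ℝ A) (hAne : A.Nonempty)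
    (hAC : A ⊆ C) {F : E → Set E} {k : ℝ} (hk0 : 0 ≤ k) (hk1 : k < 1)
    (hF : MultiLipschitzOn k F C) (hFcomp : ∀ x ∈ C, IsCompact (F x)) (hFC : ∀ x ∈ C, F x ⊆ C)
    (hFA : ∀ x ∈ A, (F x ∩ A).Nonempty) :
    ∃ K ⊆ A, IsCompact K ∧ Convex ℝ K ∧ K.Nonempty ∧ ∀ x ∈ K, (F x ∩ K).Nonempty := by
  obtain ⟨x₀, hx₀⟩ := hAne
  -- `K` will be the smallest closed convex set containing `x₀` and stable under `x ↦ F x ∩ A`.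
  -- Minimality makes it the closed convex hull of `x₀` and its own images.
  let 𝒦 : Set (Set E) := {K | IsClosed K ∧ Convex ℝ K ∧ x₀ ∈ K ∧ K ⊆ A ∧ ∀ x ∈ K, F x ∩ A ⊆ K}
  have hA𝒦 : A ∈ 𝒦 := ⟨hA, hAc, hx₀, subset_rfl, fun x _ => Set.inter_subset_right⟩
  set K := ⋂₀ 𝒦
  have hKcl : IsClosed K := isClosed_sInter fun K' h => h.1
  have hKcv : Convex ℝ K := convex_sInter fun K' h => h.2.1
  have hKx₀ : x₀ ∈ K := Set.mem_sInter.2 fun K' h => h.2.2.1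
  have hKA : K ⊆ A := Set.sInter_subset_of_mem hA𝒦
  have hKF : ∀ x ∈ K, F x ∩ A ⊆ K := fun x hx =>
    Set.subset_sInter fun K' h => h.2.2.2.2 x (Set.mem_sInter.1 hx K' h)
  set G : Set E := insert x₀ (⋃ x ∈ K, F x ∩ A)
  have hGK : G ⊆ K := Set.insert_subset hKx₀ (Set.iUnion₂_subset hKF)
  have hK' : closure (convexHull ℝ G) ∈ 𝒦 := by
    have hsub : closure (convexHull ℝ G) ⊆ K := hKcl.closure_subset_iff.2 (convexHull_min hGK hKcv)
    have hle : G ⊆ closure (convexHull ℝ G) := (subset_convexHull ℝ G).trans subset_closure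
    refine ⟨isClosed_closure, (convex_convexHull ℝ G).closure, hle (Set.mem_insert _ _),
      hsub.trans hKA, fun x hx => ?_⟩
    exact (Set.subset_iUnion₂ (s := fun x (_ : x ∈ K) => F x ∩ A) x (hsub hx)).trans
      ((Set.subset_insert _ _).trans hle)
  have hKhull : K ⊆ closure (convexHull ℝ G) := Set.sInter_subset_of_mem hK'
  let P : ℝ → Prop := fun ε => ∃ S : Set E, S.Finite ∧ S ⊆ C ∧ ∀ x ∈ K, ∃ s ∈ S, ‖x - s‖ ≤ ε
  -- A measure of noncompactness argument: an `ε`-net `S` of `K` puts the images within `k * ε` of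
  -- the compact set `⋃ s ∈ S, F s`, whose convex hull is totally bounded.
  have hstep : ∀ ε, 0 ≤ ε → ∀ η, 0 < η → P ε → P (k * ε + η) := by
    rintro ε hε η hη ⟨S, hSfin, hSC, hS⟩
    set Q : Set E := insert x₀ (⋃ s ∈ S, F s)
    have hQ : IsCompact Q := (hSfin.isCompact_biUnion fun s hs => hFcomp s (hSC hs)).insert x₀
    have hQC : Q ⊆ C := Set.insert_subset (hAC hx₀) (Set.iUnion₂_subset fun s hs => hFC s (hSC hs))
    have hH : TotallyBounded (convexHull ℝ Q) := totallyBounded_convexHull.2 hQ.totallyBounded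
    obtain ⟨S', hS'H, hS'fin, hS'⟩ := Metric.finite_approx_of_totallyBounded hH (η / 2)
      (by positivity)
    refine ⟨S', hS'fin, hS'H.trans (convexHull_min hQC hC), fun x hx => ?_⟩
    have hG : G ⊆ convexHull ℝ Q + Metric.closedBall 0 (k * ε) := by
      intro z hz
      rcases Set.mem_insert_iff.1 hz with rfl | hz
      · exact ⟨z, subset_convexHull ℝ Q (Set.mem_insert _ _), 0,
          Metric.mem_closedBall_self (by positivity), add_zero _⟩
      · obtain ⟨x, hx, hz, -⟩ := Set.mem_iUnion₂.1 hz
        obtain ⟨s, hs, hxs⟩ := hS x hx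
        obtain ⟨v, hv, hzv⟩ := hF x (hAC (hKA hx)) s (hSC hs) z hz
        refine ⟨v, subset_convexHull ℝ Q (Set.mem_insert_of_mem _ (Set.mem_iUnion₂.2 ⟨s, hs, hv⟩)),
          z - v, ?_, add_sub_cancel _ _⟩
        rw [mem_closedBall_zero_iff]
        exact hzv.trans (mul_le_mul_of_nonneg_left hxs hk0)
    have hhull := convexHull_min hG ((convex_convexHull ℝ Q).add (convex_closedBall 0 (k * ε)))
    obtain ⟨z, hz, hxz⟩ := Metric.mem_closure_iff.1 (hKhull hx) (η / 2) (by positivity)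
    obtain ⟨h, hh, b, hb, rfl⟩ := hhull hz
    obtain ⟨s, hs, hhs⟩ := Set.mem_iUnion₂.1 (hS' hh)
    refine ⟨s, hs, ?_⟩
    rw [mem_closedBall_zero_iff] at hb
    rw [Metric.mem_ball, dist_eq_norm] at hhs
    rw [dist_eq_norm] at hxz
    calc ‖x - s‖ = ‖(x - (h + b)) + (b + (h - s))‖ := by congr 1; abel
      _ ≤ ‖x - (h + b)‖ + (‖b‖ + ‖h - s‖) := norm_add_le_of_le le_rfl (norm_add_le _ _)
      _ ≤ k * ε + η := by linarith
  obtain ⟨R, hR⟩ := hCb.subset_closedBall x₀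
  have hR0 : 0 ≤ R := by simpa using hR (hAC hx₀)
  have hP : ∀ n : ℕ, P (((k + 1) / 2) ^ n * (R + 1)) := by
    intro n
    induction n with
    | zero =>
      refine ⟨{x₀}, Set.finite_singleton _, Set.singleton_subset_iff.2 (hAC hx₀),
        fun x hx => ⟨x₀, rfl, ?_⟩⟩
      have := hR (hAC (hKA hx))
      rw [Metric.mem_closedBall, dist_eq_norm] at this
      simp only [pow_zero, one_mul]
      linarith
    | succ n ih =>
      have h0 : 0 < ((k + 1) / 2) ^ n * (R + 1) := by positivity
      -- This `η` turns the factor `k` into `(k + 1) / 2`, which is still below `1`.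
      have := hstep _ h0.le ((1 - k) / 2 * (((k + 1) / 2) ^ n * (R + 1)))
        (mul_pos (by linarith) h0) ih
      convert this using 1
      ring
  have hKtb : TotallyBounded K := by
    refine Metric.totallyBounded_iff.2 fun ε hε => ?_
    have hlim : Tendsto (fun n : ℕ => ((k + 1) / 2) ^ n * (R + 1)) atTop (𝓝 (0 * (R + 1))) :=
      (tendsto_pow_atTop_nhds_zero_of_lt_one (by positivity) (by linarith)).mul_const _
    rw [zero_mul] at hlim
    obtain ⟨n, hn⟩ := (hlim.eventually_lt_const hε).exists
    obtain ⟨S, hSfin, -, hS⟩ := hP n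
    refine ⟨S, hSfin, fun x hx => ?_⟩
    obtain ⟨s, hs, hxs⟩ := hS x hx
    exact Set.mem_iUnion₂.2 ⟨s, hs, by rw [Metric.mem_ball, dist_eq_norm]; linarith⟩
  refine ⟨K, hKA, hKtb.isCompact_of_isClosed hKcl, hKcv, ⟨x₀, hKx₀⟩, fun x hx => ?_⟩
  obtain ⟨v, hv⟩ := hFA x (hKA hx)
  exact ⟨v, hv.1, hKF x hx hv⟩

/-- A nonexpansive map with compact convex values which meet the closed convex set `A` has
approximate fixed points in `A`. -/
theorem exists_approx_fixed [CompleteSpace E] {C A : Set E} (hC : Convex ℝ C)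
    (hCb : Bornology.IsBounded C) (hA : IsClosed A) (hAc : Convex ℝ A) (hAne : A.Nonempty)
    (hAC : A ⊆ C) {T : E → Set E} (hT : MapsToKC T C) (hTne : MultiLipschitzOn 1 T C)
    (hTA : ∀ x ∈ A, (T x ∩ A).Nonempty) {ε : ℝ} (hε : 0 < ε) :
    ∃ x ∈ A, ∃ v ∈ T x, ‖x - v‖ ≤ ε := by
  obtain ⟨x₀, hx₀⟩ := hAne
  obtain ⟨R, hR⟩ := hCb.subset_closedBall x₀
  have hR0 : 0 ≤ R := by simpa using hR (hAC hx₀)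
  obtain ⟨t, ht0, ht1, htR⟩ : ∃ t : ℝ, 0 < t ∧ t < 1 ∧ t * R ≤ ε / 2 := by
    refine ⟨min (1 / 2) (ε / 2 / (R + 1)), by positivity, by
      linarith [min_le_left (1 / 2) (ε / 2 / (R + 1))], ?_⟩
    calc min (1 / 2) (ε / 2 / (R + 1)) * R ≤ ε / 2 / (R + 1) * (R + 1) := by
          gcongr
          · exact min_le_right _ _
          · linarith
      _ = ε / 2 := by field_simp
  -- Shrinking towards `x₀ ∈ A` preserves the convex sets `A` and `C`, makes `T` a contraction, and
  -- moves points of `C` by at most `t * R ≤ ε / 2`.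
  let h : E →ᵃ[ℝ] E := AffineMap.homothety x₀ (1 - t)
  have hh : ∀ v, h v = (1 - t) • (v - x₀) + x₀ := fun v => by simp [h, AffineMap.homothety_apply]
  have hmem : ∀ D : Set E, Convex ℝ D → x₀ ∈ D → ∀ v ∈ D, h v ∈ D := by
    intro D hD hx v hv
    have := hD hx hv ht0.le (by linarith : 0 ≤ 1 - t) (by ring)
    convert this using 1
    rw [hh, smul_sub, sub_smul, sub_smul, one_smul, one_smul]
    abel
  let F : E → Set E := fun x => h '' T x
  have hF : MultiLipschitzOn (1 - t) F C := by
    rintro x hx y hy _ ⟨u, hu, rfl⟩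
    obtain ⟨v, hv, huv⟩ := hTne x hx y hy u hu
    refine ⟨h v, ⟨v, hv, rfl⟩, ?_⟩
    rw [hh, hh, add_sub_add_right_eq_sub, ← smul_sub, sub_sub_sub_cancel_right, norm_smul,
      Real.norm_of_nonneg (by linarith)]
    rw [one_mul] at huv
    exact mul_le_mul_of_nonneg_left huv (by linarith)
  have hcont : Continuous h := by
    have : (h : E → E) = fun v => (1 - t) • (v - x₀) + x₀ := funext hh
    rw [this]
    fun_prop
  obtain ⟨K, hKA, hK, hKc, hKne, hFK⟩ := exists_isCompact_meets hC hCb hA hAc ⟨x₀, hx₀⟩ hAC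
    (by linarith) (by linarith) hF (fun x hx => (hT x hx).2.1.image hcont)
    (by
      rintro x hx _ ⟨v, hv, rfl⟩
      exact hmem C hC (hAC hx₀) v ((hT x hx).2.2.2 hv))
    (by
      intro x hx
      obtain ⟨v, hv, hvA⟩ := hTA x hx
      exact ⟨h v, ⟨v, hv, rfl⟩, hmem A hAc hx₀ v hvA⟩)
  obtain ⟨x, hx, _, ⟨v, hv, rfl⟩, hxv⟩ := exists_approx_fixed_of_isCompact hK hKc hKne
    (by linarith : 0 ≤ 1 - t) (fun x hx y hy => hF x (hAC (hKA hx)) y (hAC (hKA hy)))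
    (fun x hx => (hT x (hAC (hKA hx))).2.2.1.affine_image h) hFK (half_pos hε)
  refine ⟨x, hKA hx, v, hv, ?_⟩
  have hvR := hR ((hT x (hAC (hKA hx))).2.2.2 hv)
  rw [Metric.mem_closedBall, dist_eq_norm] at hvR
  have heq : x - v = (x - h v) + t • (x₀ - v) := by
    rw [hh, smul_sub, smul_sub, sub_smul, sub_smul, one_smul, one_smul]
    abel
  rw [heq]
  refine (norm_add_le _ _).trans ?_
  rw [norm_smul, Real.norm_of_nonneg ht0.le, norm_sub_rev x₀ v]
  have := mul_le_mul_of_nonneg_left hvR ht0.le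
  linarith

end ApproxFixed


/-! ### Limits of bounded real sequences along ultrafilters. -/

section UltrafilterLimit

/-- The limit of a real sequence along an ultrafilter. -/
noncomputable def ulim (U : Ultrafilter ℕ) (f : ℕ → ℝ) : ℝ := limUnder (U : Filter ℕ) f

theorem tendsto_ulim (U : Ultrafilter ℕ) {f : ℕ → ℝ} {M : ℝ} (hf : ∀ n, |f n| ≤ M) :
    Tendsto f U (𝓝 (ulim U f)) := by
  obtain ⟨x, -, hx⟩ := (isCompact_Icc (a := -M) (b := M)).ultrafilter_le_nhds (U.map f)
    (le_principal_iff.2 (Filter.mem_map.2 (univ_mem' fun n => abs_le.1 (hf n))))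
  exact tendsto_nhds_limUnder ⟨x, hx⟩

theorem ulim_eq {U : Ultrafilter ℕ} {f : ℕ → ℝ} {a : ℝ} (h : Tendsto f U (𝓝 a)) : ulim U f = a :=
  h.limUnder_eq

end UltrafilterLimit

/-! ### James' theorem for uniformly nonsquare spaces, by iterated limits. -/

section James

variable {X : Type*} [NormedAddCommGroup X] [NormedSpace ℝ X]

/-- The iterated limit `lim_{n₁} ⋯ lim_{nₖ} ‖z + a₁ y_{n₁} + ⋯ + aₖ y_{nₖ}‖` along `U`. -/
noncomputable def iterNorm (U : Ultrafilter ℕ) (y : ℕ → X) : List ℝ → X → ℝ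
  | [], z => ‖z‖
  | a :: l, z => ulim U fun n => iterNorm U y l (z + a • y n)

variable {U : Ultrafilter ℕ} {y : ℕ → X} {M : ℝ}

theorem abs_iterNorm_le (hy : ∀ n, ‖y n‖ ≤ M) (l : List ℝ) (z : X) :
    |iterNorm U y l z| ≤ ‖z‖ + (l.map abs).sum * M := by
  induction l generalizing z with
  | nil => simp [iterNorm]
  | cons a l ih =>
    have hb : ∀ n, |iterNorm U y l (z + a • y n)| ≤ ‖z‖ + ((a :: l).map abs).sum * M := by
      intro n
      refine (ih _).trans ?_
      have h1 : ‖z + a • y n‖ ≤ ‖z‖ + |a| * M := by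
        refine (norm_add_le _ _).trans ?_
        rw [norm_smul, Real.norm_eq_abs]
        gcongr
        exact hy n
      rw [List.map_cons, List.sum_cons]
      linarith
    exact le_of_tendsto (tendsto_ulim U hb).abs (Eventually.of_forall hb)

theorem tendsto_iterNorm (hy : ∀ n, ‖y n‖ ≤ M) (a : ℝ) (l : List ℝ) (z : X) :
    Tendsto (fun n => iterNorm U y l (z + a • y n)) U (𝓝 (iterNorm U y (a :: l) z)) := by
  refine tendsto_ulim U (M := ‖z‖ + |a| * M + (l.map abs).sum * M) fun n => ?_
  refine (abs_iterNorm_le hy _ _).trans ?_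
  gcongr
  refine (norm_add_le _ _).trans ?_
  rw [norm_smul, Real.norm_eq_abs]
  gcongr
  exact hy n

theorem iterNorm_zero_cons (l : List ℝ) (z : X) :
    iterNorm U y (0 :: l) z = iterNorm U y l z := by
  refine ulim_eq ?_
  simp

theorem iterNorm_append_congr {l l' : List ℝ} (h : ∀ z, iterNorm U y l z = iterNorm U y l' z)
    (u : List ℝ) (z : X) : iterNorm U y (u ++ l) z = iterNorm U y (u ++ l') z := by
  induction u generalizing z with
  | nil => exact h z
  | cons a u ih => simp only [List.cons_append, iterNorm, ih]

theorem iterNorm_zeros_append (u : List ℝ) (l : List ℝ) (z : X) :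
    iterNorm U y (u.map (fun _ => (0 : ℝ)) ++ l) z = iterNorm U y l z := by
  induction u with
  | nil => rfl
  | cons a u ih => rw [List.map_cons, List.cons_append, iterNorm_zero_cons, ih]

/-- The bidual norm is weak-star lower semicontinuous, and each iterated limit replaces one `y n` by
the weak-star limit `F`. If `F` is not in `X`, lists of sum `1` thus have iterated norm at least the
distance from `F` to `X`. -/
theorem norm_bidual_le_iterNorm (hy : ∀ n, ‖y n‖ ≤ M) {F : StrongDual ℝ (StrongDual ℝ X)}
    (hF : ∀ f : StrongDual ℝ X, Tendsto (fun n => f (y n)) U (𝓝 (F f))) (l : List ℝ) (z : X) :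
    ‖NormedSpace.inclusionInDoubleDual ℝ X z + l.sum • F‖ ≤ iterNorm U y l z := by
  induction l generalizing z with
  | nil => simp only [List.sum_nil, zero_smul, add_zero]; exact NormedSpace.double_dual_bound ℝ X z
  | cons a l ih =>
    have hlim := tendsto_iterNorm (U := U) hy a l z
    refine ContinuousLinearMap.opNorm_le_bound _
      (ge_of_tendsto' hlim fun n => (norm_nonneg
        (NormedSpace.inclusionInDoubleDual ℝ X (z + a • y n) + l.sum • F)).trans (ih _)) fun f => ?_
    have h1 : Tendsto (fun n => ‖f (z + a • y n) + l.sum * F f‖) U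
        (𝓝 ‖f z + a * F f + l.sum * F f‖) := by
      simp only [map_add, map_smul, smul_eq_mul]
      exact ((((hF f).const_mul a).const_add _).add_const _).norm
    have h2 : ∀ n, ‖f (z + a • y n) + l.sum * F f‖ ≤ iterNorm U y l (z + a • y n) * ‖f‖ := by
      intro n
      refine le_trans ?_ (mul_le_mul_of_nonneg_right (ih _) (norm_nonneg f))
      exact ContinuousLinearMap.le_opNorm
        (NormedSpace.inclusionInDoubleDual ℝ X (z + a • y n) + l.sum • F) f
    have h3 := le_of_tendsto_of_tendsto' h1 (hlim.mul_const ‖f‖) h2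
    change ‖f z + (a :: l).sum * F f‖ ≤ _
    rwa [List.sum_cons, add_mul, ← add_assoc]

theorem le_iterNorm_append (hy : ∀ n, ‖y n‖ ≤ M) {d : ℝ} {l : List ℝ}
    (h : ∀ z, d ≤ iterNorm U y l z) (u : List ℝ) (z : X) : d ≤ iterNorm U y (u ++ l) z := by
  induction u generalizing z with
  | nil => exact h z
  | cons a u ih => exact ge_of_tendsto' (tendsto_iterNorm hy a (u ++ l) z) fun n => ih _

/-- Nonsquareness passes through the limits because both lists are evaluated at the same indices.
Aligning two lists differently, by inserting zeros, therefore gives different consequences. -/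
theorem min_iterNorm_le (hy : ∀ n, ‖y n‖ ≤ M) {q : ℝ}
    (hq : ∀ x x' : X, min ‖(1 / 2 : ℝ) • (x + x')‖ ‖(1 / 2 : ℝ) • (x - x')‖ ≤ q * max ‖x‖ ‖x'‖)
    (P : List (ℝ × ℝ)) (z w : X) :
    min (iterNorm U y (P.map fun p => (p.1 + p.2) / 2) ((1 / 2 : ℝ) • (z + w)))
      (iterNorm U y (P.map fun p => (p.1 - p.2) / 2) ((1 / 2 : ℝ) • (z - w))) ≤
    q * max (iterNorm U y (P.map Prod.fst) z) (iterNorm U y (P.map Prod.snd) w) := by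
  induction P generalizing z w with
  | nil => exact hq z w
  | cons p P ih =>
    obtain ⟨a, b⟩ := p
    refine le_of_tendsto_of_tendsto'
      ((tendsto_iterNorm hy _ _ _).min (tendsto_iterNorm hy _ _ _))
      (((tendsto_iterNorm hy _ _ _).max (tendsto_iterNorm hy _ _ _)).const_mul q) fun n => ?_
    have := ih (z + a • y n) (w + b • y n)
    rw [show (1 / 2 : ℝ) • (z + a • y n + (w + b • y n)) =
        (1 / 2 : ℝ) • (z + w) + ((a + b) / 2) • y n by module,
      show (1 / 2 : ℝ) • (z + a • y n - (w + b • y n)) =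
        (1 / 2 : ℝ) • (z - w) + ((a - b) / 2) • y n by module] at this
    exact this

/-- The tail sums of the list contain the alternating sequence `σ, -σ, σ, …` of length `n`. -/
def Alternating : ℕ → ℝ → List ℝ → Prop
  | 0, _, _ => True
  | n + 1, σ, l => ∃ u t, l = u ++ t ∧ t.sum = σ ∧ Alternating n (-σ) t

theorem Alternating.append {n : ℕ} {σ : ℝ} {l : List ℝ} (h : Alternating n σ l) (v : List ℝ) :
    Alternating n σ (v ++ l) := by
  cases n with
  | zero => trivial
  | succ n =>
    obtain ⟨u, t, rfl, ht⟩ := h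
    exact ⟨v ++ u, t, by simp, ht⟩

theorem Alternating.of_succ {n : ℕ} {σ : ℝ} {l : List ℝ} (h : Alternating (n + 1) σ l) :
    Alternating n σ l := by
  induction n generalizing σ l with
  | zero => trivial
  | succ n ih =>
    obtain ⟨u, t, rfl, hs, ht⟩ := h
    exact ⟨u, t, rfl, hs, ih ht⟩

theorem sum_map_half_add (P : List (ℝ × ℝ)) :
    (P.map fun p => (p.1 + p.2) / 2).sum = ((P.map Prod.fst).sum + (P.map Prod.snd).sum) / 2 := by
  induction P with
  | nil => simp
  | cons p P ih => simp only [List.map_cons, List.sum_cons, ih]; ring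

theorem sum_map_half_sub (P : List (ℝ × ℝ)) :
    (P.map fun p => (p.1 - p.2) / 2).sum = ((P.map Prod.fst).sum - (P.map Prod.snd).sum) / 2 := by
  induction P with
  | nil => simp
  | cons p P ih => simp only [List.map_cons, List.sum_cons, ih]; ring

/-- Two copies of an alternating list can be interleaved so that both the half sum and the half
difference alternate. -/
theorem Alternating.exists_staircase (U : Ultrafilter ℕ) (y : ℕ → X) {n : ℕ} {σ : ℝ} {t : List ℝ}
    (hs : t.sum = σ) (ht : Alternating n (-σ) t) :
    ∃ P : List (ℝ × ℝ), (P.map Prod.fst).sum = σ ∧ (P.map Prod.snd).sum = σ ∧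
      (∀ z, iterNorm U y (P.map Prod.fst) z = iterNorm U y t z) ∧
      (∀ z, iterNorm U y (P.map Prod.snd) z = iterNorm U y t z) ∧
      Alternating n (-σ) (P.map fun p => (p.1 + p.2) / 2) ∧
      Alternating n σ (P.map fun p => (p.1 - p.2) / 2) := by
  induction n generalizing σ t with
  | zero =>
    refine ⟨t.map fun a => (a, a), ?_, ?_, ?_, ?_, trivial, trivial⟩ <;>
      simp [Function.comp_def, hs]
  | succ n ih =>
    obtain ⟨u, t', rfl, hs', ht'⟩ := ht
    obtain ⟨P, hP1, hP2, hN1, hN2, hA1, hA2⟩ := ih hs' ht'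
    rw [neg_neg] at hA1
    -- Placing the two copies of `u` one after the other, padded by zeros, leaves both iterated
    -- norms unchanged. Past the first block the half difference has tail sum `u.sum / 2 = (σ -
    -- (-σ)) / 2 = σ`.
    refine ⟨u.map (fun b => ((0 : ℝ), b)) ++ (u.map (fun a => (a, (0 : ℝ))) ++ P),
      ?_, ?_, ?_, ?_, ?_, ?_⟩
    · simp only [List.map_append, List.map_map, List.sum_append, Function.comp_def, hP1]
      rw [List.sum_append, hs'] at hs
      simpa using hs
    · simp only [List.map_append, List.map_map, List.sum_append, Function.comp_def, hP2]
      rw [List.sum_append, hs'] at hs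
      simpa using hs
    · intro z
      simp only [List.map_append, List.map_map, Function.comp_def, List.map_id']
      rw [iterNorm_zeros_append]
      exact iterNorm_append_congr hN1 u z
    · intro z
      simp only [List.map_append, List.map_map, Function.comp_def, List.map_id']
      refine iterNorm_append_congr (fun z => ?_) u z
      rw [iterNorm_zeros_append, hN2]
    · simp only [List.map_append]
      apply Alternating.append
      apply Alternating.append
      refine ⟨[], _, rfl, ?_, ?_⟩
      · rw [sum_map_half_add, hP1, hP2]; ring
      · rwa [neg_neg]
    · rw [List.map_append]
      apply Alternating.append
      refine ⟨[], _, rfl, ?_, ?_⟩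
      · rw [sum_map_half_sub]
        simp only [List.map_append, List.map_map, List.sum_append, Function.comp_def, hP1, hP2,
          List.map_id']
        rw [List.sum_append, hs'] at hs
        simp
        linarith
      · rw [List.map_append]
        exact Alternating.append hA2 _

/-- Each use of nonsquareness gains a factor `q` and costs one alternation: the half sum and the
half difference of the interleaved copies both still alternate, with one sign change fewer. When a
single tail of sum `1` remains, `hd` applies. -/
theorem le_pow_mul_iterNorm (hy : ∀ n, ‖y n‖ ≤ M) {q : ℝ} (hq0 : 0 ≤ q)
    (hq : ∀ x x' : X, min ‖(1 / 2 : ℝ) • (x + x')‖ ‖(1 / 2 : ℝ) • (x - x')‖ ≤ q * max ‖x‖ ‖x'‖)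
    {d : ℝ} (hd : ∀ t : List ℝ, t.sum = 1 → ∀ z, d ≤ iterNorm U y t z) (n : ℕ) (l : List ℝ)
    (hl : Alternating (n + 1) 1 l) : d ≤ q ^ n * iterNorm U y l 0 := by
  induction n generalizing l with
  | zero =>
    obtain ⟨u, t, rfl, ht, -⟩ := hl
    rw [pow_zero, one_mul]
    exact le_iterNorm_append hy (hd t ht) u 0
  | succ n ih =>
    obtain ⟨u, t, rfl, ht, hAt⟩ := hl
    obtain ⟨P, hP1, hP2, hN1, hN2, hA1, hA2⟩ := hAt.exists_staircase U y ht
    have key := min_iterNorm_le (U := U) hy hq (u.map (fun a => (a, a)) ++ P) 0 0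
    simp only [List.map_append, List.map_map, Function.comp_def, List.map_id', add_zero,
      smul_zero, add_self_div_two, sub_self, zero_div] at key
    rw [iterNorm_append_congr hN1, iterNorm_append_congr hN2, max_self] at key
    have h1 : d ≤ q ^ n * iterNorm U y
        (u ++ P.map fun p => (p.1 + p.2) / 2) 0 :=
      ih _ (Alternating.of_succ ⟨u, _, rfl, by rw [sum_map_half_add, hP1, hP2]; ring, hA1⟩)
    have h2 : d ≤ q ^ n * iterNorm U y
        (u.map (fun _ => (0 : ℝ)) ++ P.map fun p => (p.1 - p.2) / 2) 0 := ih _ (hA2.append _)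
    rw [pow_succ, mul_assoc]
    refine le_trans ?_ (mul_le_mul_of_nonneg_left key (pow_nonneg hq0 n))
    rcases min_choice (iterNorm U y (u ++ P.map fun p => (p.1 + p.2) / 2) 0)
      (iterNorm U y (u.map (fun _ => (0 : ℝ)) ++ P.map fun p => (p.1 - p.2) / 2) 0) with h | h <;>
    · rw [h]
      assumption

/-- A list of `n` coefficients whose tail sums are `σ, -σ, σ, …`. -/
noncomputable def altList : ℕ → ℝ → List ℝ
  | 0, _ => []
  | n + 1, σ => (σ - (altList n (-σ)).sum) :: altList n (-σ)

theorem sum_altList_succ (n : ℕ) (σ : ℝ) : (altList (n + 1) σ).sum = σ := by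
  simp [altList]

theorem alternating_altList (n : ℕ) (σ : ℝ) : Alternating n σ (altList n σ) := by
  induction n generalizing σ with
  | zero => trivial
  | succ n ih =>
    exact ⟨[], _, rfl, sum_altList_succ n σ, (ih (-σ)).append [σ - (altList n (-σ)).sum]⟩

theorem sum_abs_altList_le (n : ℕ) (σ : ℝ) : ((altList n σ).map abs).sum ≤ n * (2 * |σ|) := by
  induction n generalizing σ with
  | zero => simp [altList]
  | succ n ih =>
    have h1 : |σ - (altList n (-σ)).sum| ≤ 2 * |σ| := by
      cases n with
      | zero =>
        simp only [altList, List.sum_nil, sub_zero]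
        linarith [abs_nonneg σ]
      | succ n =>
        rw [sum_altList_succ, sub_neg_eq_add, ← two_mul, abs_mul, abs_two]
    have h2 := ih (-σ)
    rw [abs_neg] at h2
    simp only [altList, List.map_cons, List.sum_cons]
    push_cast
    linarith

/-- James: in a uniformly nonsquare Banach space, every bounded sequence has a weak limit along
every ultrafilter. -/
theorem exists_weak_ulim [CompleteSpace X] {q : ℝ} (hq0 : 0 ≤ q) (hq1 : q < 1)
    (hq : ∀ x x' : X, min ‖(1 / 2 : ℝ) • (x + x')‖ ‖(1 / 2 : ℝ) • (x - x')‖ ≤ q * max ‖x‖ ‖x'‖)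
    (U : Ultrafilter ℕ) {y : ℕ → X} {M : ℝ} (hy : ∀ n, ‖y n‖ ≤ M) :
    ∃ w, ∀ f : X →L[ℝ] ℝ, Tendsto (fun n => f (y n)) U (𝓝 (f w)) := by
  have hM : 0 ≤ M := (norm_nonneg _).trans (hy 0)
  have hb : ∀ (f : StrongDual ℝ X) n, |f (y n)| ≤ M * ‖f‖ := by
    intro f n
    rw [mul_comm]
    exact (f.le_opNorm _).trans (mul_le_mul_of_nonneg_left (hy n) (norm_nonneg f))
  have hlim : ∀ f : StrongDual ℝ X, Tendsto (fun n => f (y n)) U (𝓝 (ulim U fun n => f (y n))) :=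
    fun f => tendsto_ulim U (hb f)
  let F₀ : StrongDual ℝ X →ₗ[ℝ] ℝ :=
    { toFun := fun f => ulim U fun n => f (y n)
      map_add' := fun f g => ulim_eq ((hlim f).add (hlim g))
      map_smul' := fun a f => ulim_eq ((hlim f).const_mul a) }
  let F : StrongDual ℝ (StrongDual ℝ X) := F₀.mkContinuous M fun f =>
    le_of_tendsto (hlim f).norm (Eventually.of_forall (hb f))
  have hF : ∀ f : StrongDual ℝ X, Tendsto (fun n => f (y n)) U (𝓝 (F f)) := hlim
  by_cases hmem : F ∈ Set.range (NormedSpace.inclusionInDoubleDual ℝ X)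
  · obtain ⟨w, hw⟩ := hmem
    refine ⟨w, fun f => ?_⟩
    have := hF f
    rwa [← hw, NormedSpace.dual_def] at this
  exfalso
  have hiso : Isometry (NormedSpace.inclusionInDoubleDual ℝ X) :=
    (NormedSpace.inclusionInDoubleDualLi ℝ).isometry
  have hclosed : IsClosed (Set.range (NormedSpace.inclusionInDoubleDual ℝ X)) :=
    hiso.isClosedEmbedding.isClosed_range
  have hd := (hclosed.notMem_iff_infDist_pos (Set.range_nonempty _)).1 hmem
  set d := Metric.infDist F (Set.range (NormedSpace.inclusionInDoubleDual ℝ X))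
  have hdle : ∀ t : List ℝ, t.sum = 1 → ∀ z, d ≤ iterNorm U y t z := by
    intro t ht z
    refine le_trans ?_ (norm_bidual_le_iterNorm hy hF t z)
    have : d ≤ ‖F - NormedSpace.inclusionInDoubleDual ℝ X (-z)‖ :=
      (Metric.infDist_le_dist_of_mem (Set.mem_range_self (-z))).trans_eq (dist_eq_norm F _)
    rwa [map_neg, sub_neg_eq_add, add_comm, ← one_smul ℝ F, ← ht] at this
  -- The norm of an alternating list grows only linearly in its length, while the gain `q ^ n` is
  -- geometric.
  have hupper : ∀ n : ℕ, d ≤ (n * q ^ n + q ^ n) * (2 * M) := by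
    intro n
    refine (le_pow_mul_iterNorm hy hq0 hq hdle n _ (alternating_altList (n + 1) 1)).trans ?_
    have h1 := (le_abs_self _).trans (abs_iterNorm_le (U := U) hy (altList (n + 1) 1) 0)
    have h2 := mul_le_mul_of_nonneg_right (sum_abs_altList_le (n + 1) 1) hM
    rw [norm_zero, zero_add] at h1
    calc q ^ n * iterNorm U y (altList (n + 1) 1) 0
        ≤ q ^ n * (((n + 1 : ℕ) : ℝ) * (2 * |1|) * M) :=
          mul_le_mul_of_nonneg_left (h1.trans h2) (pow_nonneg hq0 n)
      _ = (n * q ^ n + q ^ n) * (2 * M) := by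
          push_cast
          rw [abs_one]
          ring
  have hzero : Tendsto (fun n : ℕ => (n * q ^ n + q ^ n) * (2 * M)) atTop
      (𝓝 ((0 + 0) * (2 * M))) :=
    ((tendsto_self_mul_const_pow_of_lt_one hq0 hq1).add
      (tendsto_pow_atTop_nhds_zero_of_lt_one hq0 hq1)).mul_const _
  rw [add_zero, zero_mul] at hzero
  exact absurd (ge_of_tendsto' hzero hupper) (not_le.2 hd)

end James


/-! ### Weak limits along filters, and the coefficient of weak orthogonality. -/

section WeakLimits

variable {X : Type*} [NormedAddCommGroup X] [NormedSpace ℝ X]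

/-- The sequence `y` converges weakly to `w` along the filter `l`. -/
def WeakLim (l : Filter ℕ) (y : ℕ → X) (w : X) : Prop :=
  ∀ f : X →L[ℝ] ℝ, Tendsto (fun n => f (y n)) l (𝓝 (f w))

/-- Every bounded sequence converges weakly along every ultrafilter. -/
def HasWeakLimits (X : Type*) [NormedAddCommGroup X] [NormedSpace ℝ X] : Prop :=
  ∀ (U : Ultrafilter ℕ) (y : ℕ → X) (M : ℝ), (∀ n, ‖y n‖ ≤ M) → ∃ w, WeakLim U y w

/-- Mazur: a closed convex set is an intersection of closed half-spaces, by Hahn–Banach. -/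
theorem WeakLim.mem {l : Filter ℕ} [l.NeBot] {y : ℕ → X} {w : X} (h : WeakLim l y w) {C : Set X}
    (hC : IsClosed C) (hCc : Convex ℝ C) (hy : ∀ᶠ n in l, y n ∈ C) : w ∈ C := by
  by_contra hw
  obtain ⟨f, u, hfu, hu⟩ := geometric_hahn_banach_closed_point hCc hC hw
  exact absurd (le_of_tendsto (h f) (hy.mono fun n hn => (hfu _ hn).le)) (not_le.2 hu)

theorem WeakLim.norm_le {l : Filter ℕ} [l.NeBot] {y : ℕ → X} {w : X} (h : WeakLim l y w) {L : ℝ}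
    (hy : Tendsto (fun n => ‖y n‖) l (𝓝 L)) : ‖w‖ ≤ L := by
  refine le_of_forall_pos_le_add fun ε hε => ?_
  have := h.mem Metric.isClosed_closedBall (convex_closedBall (0 : X) (L + ε))
    ((hy.eventually_lt_const (lt_add_of_pos_right L hε)).mono fun n hn => by
      rw [mem_closedBall_zero_iff]; exact hn.le)
  rwa [mem_closedBall_zero_iff] at this

theorem WeakLim.add {l : Filter ℕ} {y y' : ℕ → X} {w w' : X} (h : WeakLim l y w)
    (h' : WeakLim l y' w') : WeakLim l (fun n => y n + y' n) (w + w') := fun f => by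
  simpa using (h f).add (h' f)

theorem WeakLim.const_smul {l : Filter ℕ} {y : ℕ → X} {w : X} (h : WeakLim l y w) (a : ℝ) :
    WeakLim l (fun n => a • y n) (a • w) := fun f => by
  simpa using (h f).const_mul a

theorem weakLim_const (l : Filter ℕ) (w : X) : WeakLim l (fun _ => w) w :=
  fun _ => tendsto_const_nhds

theorem WeakLim.sub {l : Filter ℕ} {y y' : ℕ → X} {w w' : X} (h : WeakLim l y w)
    (h' : WeakLim l y' w') : WeakLim l (fun n => y n - y' n) (w - w') := fun f => by
  simpa using (h f).sub (h' f)

theorem WeaklyNull.weakLim {u : ℕ → X} (hu : WeaklyNull u) : WeakLim atTop u 0 := fun f => by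
  simpa using hu f

theorem WeaklyNull.bounded {u : ℕ → X} (hu : WeaklyNull u) : ∃ M, ∀ n, ‖u n‖ ≤ M := by
  obtain ⟨M, hM⟩ := banach_steinhaus (g := fun n => NormedSpace.inclusionInDoubleDual ℝ X (u n))
    (fun f => by
      obtain ⟨M, hM⟩ := (hu f).norm.bddAbove_range
      exact ⟨M, fun n => hM ⟨n, rfl⟩⟩)
  refine ⟨M, fun n => le_trans (le_of_eq ?_) (hM n)⟩
  exact ((NormedSpace.inclusionInDoubleDualLi ℝ).norm_map (u n)).symm

/-- Countably many functionals separate the points of a separable closed subspace from `0`. -/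
theorem exists_separating (y : ℕ → X) : ∃ g : ℕ → X →L[ℝ] ℝ,
    ∀ w ∈ (Submodule.span ℝ (Set.range y)).topologicalClosure, (∀ k, g k w = 0) → w = 0 := by
  have hsep : TopologicalSpace.IsSeparable (closure (Submodule.span ℝ (Set.range y) : Set X)) :=
    ((Set.countable_range y).isSeparable.span).closure
  obtain ⟨c, hc, hcl⟩ := hsep
  have hcne : c.Nonempty := by
    rw [← closure_nonempty_iff]
    exact ⟨0, hcl (subset_closure (Submodule.zero_mem _))⟩
  obtain ⟨d, rfl⟩ := hc.exists_eq_range hcne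
  -- Norming functionals of a dense sequence: if `g k w = 0` for all `k`, then `‖d k‖ ≤ ‖w - d k‖`,
  -- and `d k` can be taken close to `w`.
  choose g hg1 hgd using fun k => exists_dual_vector'' ℝ (d k)
  refine ⟨g, fun w hw hgw => ?_⟩
  rw [← norm_le_zero_iff]
  refine le_of_forall_pos_le_add fun ε hε => ?_
  obtain ⟨_, ⟨k, rfl⟩, hk⟩ := Metric.mem_closure_iff.1 (hcl hw) (ε / 2) (by positivity)
  rw [dist_eq_norm] at hk
  have h1 : ‖d k‖ ≤ ‖w - d k‖ := by
    have h2 : ‖g k (w - d k)‖ ≤ 1 * ‖w - d k‖ := (g k).le_of_opNorm_le (hg1 k) _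
    rw [map_sub, hgw k, hgd k, zero_sub, norm_neg, one_mul] at h2
    simpa using h2
  have h3 := norm_add_le (w - d k) (d k)
  rw [sub_add_cancel] at h3
  linarith

/-- A sequence converging weakly to zero along an ultrafilter has a weakly null reindexing along
which the norms of two translates have the same limits. -/
theorem exists_weaklyNull_comp (hX : HasWeakLimits X) {U : Ultrafilter ℕ} {y : ℕ → X} {M : ℝ}
    (hy : ∀ n, ‖y n‖ ≤ M) (h0 : WeakLim U y 0) {v v' : X} {L L' : ℝ}
    (hL : Tendsto (fun n => ‖y n + v‖) U (𝓝 L)) (hL' : Tendsto (fun n => ‖y n + v'‖) U (𝓝 L')) :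
    ∃ φ : ℕ → ℕ, WeaklyNull (fun j => y (φ j)) ∧ Tendsto (fun j => ‖y (φ j) + v‖) atTop (𝓝 L) ∧
      Tendsto (fun j => ‖y (φ j) + v'‖) atTop (𝓝 L') := by
  obtain ⟨g, hg⟩ := exists_separating y
  -- Diagonal choice: `φ j` makes the first `j + 1` separating functionals and both norm errors
  -- small.
  have hex : ∀ j : ℕ, ∃ n, (∀ k ∈ Finset.range (j + 1), dist (g k (y n)) 0 < 1 / ((j : ℝ) + 1)) ∧
      dist ‖y n + v‖ L < 1 / ((j : ℝ) + 1) ∧ dist ‖y n + v'‖ L' < 1 / ((j : ℝ) + 1) := by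
    intro j
    have hj : 0 < 1 / ((j : ℝ) + 1) := by positivity
    have h1 : ∀ᶠ n in (U : Filter ℕ), ∀ k ∈ Finset.range (j + 1),
        dist (g k (y n)) 0 < 1 / ((j : ℝ) + 1) := by
      refine (Filter.eventually_all_finset _).2 fun k _ => ?_
      have := h0 (g k)
      rw [map_zero] at this
      exact Metric.tendsto_nhds.1 this _ hj
    exact (h1.and ((Metric.tendsto_nhds.1 hL _ hj).and (Metric.tendsto_nhds.1 hL' _ hj))).exists
  choose φ hφg hφL hφL' using hex
  have hone := tendsto_one_div_add_atTop_nhds_zero_nat (𝕜 := ℝ)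
  have hlim : ∀ {f : ℕ → ℝ} {a : ℝ} (k : ℕ), (∀ j, k ≤ j → dist (f j) a < 1 / ((j : ℝ) + 1)) →
      Tendsto f atTop (𝓝 a) := by
    intro f a k h
    rw [tendsto_iff_dist_tendsto_zero]
    exact squeeze_zero' (Eventually.of_forall fun _ => dist_nonneg)
      ((eventually_ge_atTop k).mono fun j hj => (h j hj).le) hone
  refine ⟨φ, fun f => ?_, hlim 0 fun j _ => hφL j, hlim 0 fun j _ => hφL' j⟩
  rw [tendsto_iff_ultrafilter]
  intro V hV
  obtain ⟨w, hw⟩ := hX V (fun j => y (φ j)) M fun j => hy _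
  have hwS := hw.mem (Submodule.isClosed_topologicalClosure _)
    (Submodule.convex _) (Eventually.of_forall fun j =>
      Submodule.le_topologicalClosure _ (Submodule.subset_span (Set.mem_range_self (φ j))))
  -- Every ultrafilter weak limit of the reindexed sequence lies in the closed span and is
  -- annihilated by all `g k`; hence the whole sequence is weakly null.
  have hw0 : w = 0 := hg w hwS fun k =>
    tendsto_nhds_unique (hw (g k)) ((hlim k fun j hj =>
      hφg j k (Finset.mem_range.2 (Nat.lt_succ_of_le hj))).mono_left hV)
  have := hw f
  rwa [hw0, map_zero] at this

/-- The constant `3` is admissible in the definition of the coefficient of weak orthogonality. -/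
theorem three_mem_weakOrthSet {u : ℕ → X} (hu : WeaklyNull u) (x : X) :
    liminf (fun n => ‖u n + x‖) atTop ≤ 3 * liminf (fun n => ‖u n - x‖) atTop := by
  obtain ⟨M, hM⟩ := hu.bounded
  set L := liminf (fun n => ‖u n - x‖) atTop
  refine le_of_forall_pos_le_add fun ε hε => ?_
  have hcob : IsCoboundedUnder (· ≥ ·) atTop fun n => ‖u n - x‖ := by
    refine IsBoundedUnder.isCoboundedUnder_ge ⟨M + ‖x‖, ?_⟩
    rw [eventually_map]
    exact Eventually.of_forall fun n => (norm_sub_le _ _).trans (by gcongr; exact hM n)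
  have hfreq : ∃ᶠ n in atTop, ‖u n - x‖ < L + ε / 3 :=
    frequently_lt_of_liminf_lt hcob (by linarith)
  -- Weak lower semicontinuity along the indices that nearly realise the lower limit; then `‖u n +
  -- x‖ ≤ ‖u n - x‖ + 2 * ‖x‖`.
  have hx : ‖x‖ ≤ L + ε / 3 := by
    have hne : (atTop ⊓ 𝓟 {n | ‖u n - x‖ < L + ε / 3}).NeBot := frequently_mem_iff_neBot.1 hfreq
    have h1 : WeakLim (atTop ⊓ 𝓟 {n | ‖u n - x‖ < L + ε / 3}) (fun n => u n - x) (0 - x) :=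
      WeakLim.sub (fun f => (hu.weakLim f).mono_left inf_le_left) (weakLim_const _ x)
    have h2 := h1.mem Metric.isClosed_closedBall (convex_closedBall (0 : X) (L + ε / 3))
      (mem_inf_of_right (mem_principal.2 fun n hn => by
        rw [Set.mem_ofPred_eq, mem_closedBall_zero_iff]
        exact (le_of_lt hn)))
    rwa [mem_closedBall_zero_iff, zero_sub, norm_neg] at h2
  refine liminf_le_of_frequently_le (hfreq.mono fun n hn => ?_)
    ⟨0, by rw [eventually_map]; exact Eventually.of_forall fun n => norm_nonneg _⟩
  have h3 : ‖u n + x‖ ≤ ‖u n - x‖ + (‖x‖ + ‖x‖) := by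
    calc ‖u n + x‖ = ‖(u n - x) + (x + x)‖ := by congr 1; abel
      _ ≤ _ := norm_add_le_of_le le_rfl (norm_add_le _ _)
  linarith

theorem one_le_weakOrthCoeff [Nontrivial X] : 1 ≤ weakOrthCoeff X := by
  refine le_csInf ⟨3, by norm_num, fun u hu x => three_mem_weakOrthSet hu x⟩ ?_
  rintro t ⟨-, ht⟩
  obtain ⟨x, hx⟩ := exists_ne (0 : X)
  have h := ht (fun _ => 0) (fun f => by simp) x
  simp only [zero_add, zero_sub, norm_neg, liminf_const] at h
  exact le_of_mul_le_mul_right (by rwa [one_mul]) (norm_pos_iff.2 hx)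

/-- The coefficient of weak orthogonality controls limits along ultrafilters. -/
theorem le_weakOrthCoeff_mul (hX : HasWeakLimits X) {U : Ultrafilter ℕ} {y : ℕ → X} {M : ℝ}
    (hy : ∀ n, ‖y n‖ ≤ M) (h0 : WeakLim U y 0) {v : X} {L L' : ℝ}
    (hL : Tendsto (fun n => ‖y n + v‖) U (𝓝 L)) (hL' : Tendsto (fun n => ‖y n - v‖) U (𝓝 L')) :
    L ≤ weakOrthCoeff X * L' := by
  simp only [sub_eq_add_neg] at hL'
  obtain ⟨φ, hnull, h1, h2⟩ := exists_weaklyNull_comp hX hy h0 hL hL'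
  simp only [← sub_eq_add_neg] at h2
  have hall : ∀ t : ℝ, (0 < t ∧ ∀ u : ℕ → X, WeaklyNull u → ∀ x : X,
      liminf (fun n => ‖u n + x‖) atTop ≤ t * liminf (fun n => ‖u n - x‖) atTop) → L ≤ t * L' := by
    intro t ht
    have := ht.2 _ hnull v
    rwa [h1.liminf_eq, h2.liminf_eq] at this
  have h3 : (0 : ℝ) < 3 ∧ ∀ u : ℕ → X, WeaklyNull u → ∀ x : X,
      liminf (fun n => ‖u n + x‖) atTop ≤ 3 * liminf (fun n => ‖u n - x‖) atTop :=
    ⟨by norm_num, fun u hu x => three_mem_weakOrthSet hu x⟩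
  have hL'0 : 0 ≤ L' := ge_of_tendsto' h2 fun n => norm_nonneg _
  rcases hL'0.eq_or_lt with h | h
  · have := hall 3 h3
    rw [← h, mul_zero] at this ⊢
    exact this
  · rw [← div_le_iff₀ h]
    exact le_csInf ⟨3, h3⟩ fun t ht => (div_le_iff₀ h).2 (hall t ht)

end WeakLimits


/-! ### The skew constant: nonsquareness and the asymptotic center estimate. -/

section Constants

variable {X : Type*} [NormedAddCommGroup X] [NormedSpace ℝ X]

/-- The inequality defining the skew constant, cleared of denominators; `c` is the constant
multiplied by `2 ^ (p - 3) * (lam ^ p + mu ^ p)`. -/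
def SkewIneq (X : Type*) [NormedAddCommGroup X] [NormedSpace ℝ X] (p lam mu c : ℝ) : Prop :=
  ∀ x₁ x₂ : X, min (‖lam • x₁ + mu • x₂‖ ^ p) (‖mu • x₁ - lam • x₂‖ ^ p) ≤
    c * (‖x₁‖ ^ p + ‖x₂‖ ^ p)

variable {p lam mu : ℝ}

theorem skewIneq_skewConst (hp : 1 ≤ p) (hlam : 0 < lam) (hmu : 0 < mu) :
    SkewIneq X p lam mu (skewConst p lam mu X * ((2 : ℝ) ^ (p - 3) * (lam ^ p + mu ^ p))) := by
  have hp0 : 0 < p := by linarith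
  set D := (2 : ℝ) ^ (p - 3) * (lam ^ p + mu ^ p)
  have hD : 0 < D := by positivity
  intro x₁ x₂
  by_cases h0 : (x₁, x₂) = (0, 0)
  · obtain ⟨rfl, rfl⟩ := Prod.mk.inj h0
    simp [Real.zero_rpow hp0.ne']
  have hS : ∀ x₁ x₂ : X, (x₁, x₂) ≠ (0, 0) → 0 < ‖x₁‖ ^ p + ‖x₂‖ ^ p := by
    intro x₁ x₂ h0
    by_cases h1 : x₁ = 0
    · have h2 : x₂ ≠ 0 := fun h2 => h0 (by rw [h1, h2])
      have := Real.rpow_pos_of_pos (norm_pos_iff.2 h2) p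
      positivity
    · have := Real.rpow_pos_of_pos (norm_pos_iff.2 h1) p
      positivity
  have hbdd : BddAbove {c : ℝ | ∃ x₁ x₂ : X, (x₁, x₂) ≠ (0, 0) ∧
      c = min (‖lam • x₁ + mu • x₂‖ ^ p) (‖mu • x₁ - lam • x₂‖ ^ p) /
        (D * (‖x₁‖ ^ p + ‖x₂‖ ^ p))} := by
    refine ⟨(lam + mu) ^ p / D, ?_⟩
    rintro _ ⟨x₁, x₂, h0, rfl⟩
    rw [div_le_div_iff₀ (mul_pos hD (hS x₁ x₂ h0)) hD]
    have h1 : ‖lam • x₁ + mu • x₂‖ ≤ (lam + mu) * max ‖x₁‖ ‖x₂‖ := by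
      refine (norm_add_le _ _).trans ?_
      rw [norm_smul, norm_smul, Real.norm_of_nonneg hlam.le, Real.norm_of_nonneg hmu.le, add_mul]
      gcongr
      · exact le_max_left _ _
      · exact le_max_right _ _
    have h2 : max ‖x₁‖ ‖x₂‖ ^ p ≤ ‖x₁‖ ^ p + ‖x₂‖ ^ p := by
      rcases max_choice ‖x₁‖ ‖x₂‖ with h | h <;> rw [h]
      · linarith [Real.rpow_nonneg (norm_nonneg x₂) p]
      · linarith [Real.rpow_nonneg (norm_nonneg x₁) p]
    have h3 : ‖lam • x₁ + mu • x₂‖ ^ p ≤ (lam + mu) ^ p * (‖x₁‖ ^ p + ‖x₂‖ ^ p) := by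
      refine (Real.rpow_le_rpow (norm_nonneg _) h1 hp0.le).trans ?_
      rw [Real.mul_rpow (by positivity) (by positivity)]
      gcongr
    calc _ ≤ ‖lam • x₁ + mu • x₂‖ ^ p * D := by gcongr; exact min_le_left _ _
      _ ≤ (lam + mu) ^ p * (‖x₁‖ ^ p + ‖x₂‖ ^ p) * D := by gcongr
      _ = _ := by ring
  have h1 := le_csSup hbdd ⟨x₁, x₂, h0, rfl⟩
  rw [div_le_iff₀ (mul_pos hD (hS x₁ x₂ h0)), ← mul_assoc] at h1
  exact h1

/-- Test on `x₁ = x₂`. This also shows that `c` is nonnegative. -/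
theorem SkewIneq.sub_rpow_le [Nontrivial X] (hp : 1 ≤ p) (hlam : 0 < lam) (hmu : 0 < mu) {c : ℝ}
    (h : SkewIneq X p lam mu c) : |lam - mu| ^ p ≤ 2 * c := by
  obtain ⟨x, hx⟩ := exists_ne (0 : X)
  have hxp := Real.rpow_pos_of_pos (norm_pos_iff.2 hx) p
  have h1 := h x x
  rw [← add_smul, ← sub_smul, norm_smul, norm_smul, Real.norm_of_nonneg (by positivity),
    Real.norm_eq_abs, abs_sub_comm, Real.mul_rpow (by positivity) (norm_nonneg _),
    Real.mul_rpow (abs_nonneg _) (norm_nonneg _), min_eq_right] at h1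
  · refine le_of_mul_le_mul_right ?_ hxp
    linarith
  · gcongr
    rw [abs_le]
    constructor <;> linarith

/-- The bound on the skew constant forces the bracket to be positive and the space to be uniformly
nonsquare. -/
theorem bracket_pos_and_nonsquare [Nontrivial X] (hp : 1 ≤ p) (hlam : 0 < lam) (hmu : 0 < mu)
    {c w : ℝ} (hw : 1 ≤ w) (h : SkewIneq X p lam mu c)
    (hc : c * (w ^ p * (w ^ p + 1)) < (min lam mu * (w ^ 2 + 1) - |lam - mu| * w) ^ p) :
    0 < min lam mu * (w ^ 2 + 1) - |lam - mu| * w ∧ 2 * c < (lam + mu) ^ p := by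
  have hp0 : 0 < p := by linarith
  have hw0 : 0 < w := by linarith
  have hwp : 1 ≤ w ^ p := Real.one_le_rpow hw hp0.le
  have hm : 0 < min lam mu := lt_min hlam hmu
  have hd := abs_nonneg (lam - mu)
  have hsum : 2 * min lam mu + |lam - mu| = lam + mu := by
    rcases le_total lam mu with h | h
    · rw [min_eq_left h, abs_of_nonpos (by linarith)]; ring
    · rw [min_eq_right h, abs_of_nonneg (by linarith)]; ring
  have hsub := h.sub_rpow_le hp hlam hmu
  have hc0 : 0 ≤ c := by
    have := Real.rpow_nonneg hd p
    linarith
  -- No sign convention for powers of negative numbers is needed: if the bracket were nonpositive,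
  -- its absolute value would be at most `|lam - mu| * w`, and the test on equal vectors contradicts
  -- `hc`.
  have hβ : 0 < min lam mu * (w ^ 2 + 1) - |lam - mu| * w := by
    by_contra! hneg
    have h1 : |min lam mu * (w ^ 2 + 1) - |lam - mu| * w| ≤ |lam - mu| * w := by
      rw [abs_of_nonpos hneg]
      have : 0 < min lam mu * (w ^ 2 + 1) := by positivity
      linarith
    have h2 := ((le_abs_self _).trans (Real.abs_rpow_le_abs_rpow
      (min lam mu * (w ^ 2 + 1) - |lam - mu| * w) p)).trans
      (Real.rpow_le_rpow (abs_nonneg _) h1 hp0.le)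
    rw [Real.mul_rpow hd hw0.le] at h2
    have h3 := hc.trans_le h2
    have h4 : |lam - mu| ^ p * w ^ p ≤ c * (w ^ p * (w ^ p + 1)) := by
      calc |lam - mu| ^ p * w ^ p ≤ 2 * c * w ^ p := by gcongr
        _ = c * (w ^ p * (1 + 1)) := by ring
        _ ≤ c * (w ^ p * (w ^ p + 1)) := by gcongr
    linarith
  refine ⟨hβ, ?_⟩
  have hβle : min lam mu * (w ^ 2 + 1) - |lam - mu| * w ≤ w * ((lam + mu) * ((w + 1) / 2)) := by
    have h1 : min lam mu * (w ^ 2 + 1) ≤ min lam mu * (w * (w + 1)) := by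
      gcongr
      nlinarith
    have h2 : 0 ≤ |lam - mu| * w := by positivity
    have h3 : min lam mu * (w * (w + 1)) ≤ (lam + mu) / 2 * (w * (w + 1)) := by
      gcongr
      linarith
    linarith
  have hmean : ((w + 1) / 2) ^ p ≤ (w ^ p + 1) / 2 := by
    have := (convexOn_rpow hp).2 (Set.mem_Ici.2 hw0.le) (Set.mem_Ici.2 zero_le_one)
      (by norm_num : (0 : ℝ) ≤ 1 / 2) (by norm_num : (0 : ℝ) ≤ 1 / 2) (by norm_num)
    simp only [smul_eq_mul, Real.one_rpow] at this
    calc ((w + 1) / 2) ^ p = (1 / 2 * w + 1 / 2 * 1) ^ p := by congr 1; ring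
      _ ≤ _ := this
      _ = _ := by ring
  have h1 : (min lam mu * (w ^ 2 + 1) - |lam - mu| * w) ^ p ≤
      w ^ p * ((lam + mu) ^ p * ((w ^ p + 1) / 2)) := by
    refine (Real.rpow_le_rpow hβ.le hβle hp0.le).trans ?_
    rw [Real.mul_rpow hw0.le (by positivity), Real.mul_rpow (by positivity) (by positivity)]
    gcongr
  have h2 := hc.trans_le h1
  have h3 : c * (w ^ p * (w ^ p + 1)) < (lam + mu) ^ p / 2 * (w ^ p * (w ^ p + 1)) := by
    linarith
  have h4 := lt_of_mul_lt_mul_right h3 (by positivity)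
  linarith

/-- `max lam mu • (x ± x')` differs from a skew combination by at most `|lam - mu| * max ‖x‖ ‖x'‖`,
and `2 * max lam mu = lam + mu + |lam - mu|`. Hence `(2c)^(1/p) < lam + mu` leaves a factor `q < 1`.
-/
theorem SkewIneq.nonsquare (hp : 1 ≤ p) (hlam : 0 < lam) (hmu : 0 < mu) {c : ℝ} (hc0 : 0 ≤ c)
    (h : SkewIneq X p lam mu c) (hc : 2 * c < (lam + mu) ^ p) :
    ∃ q : ℝ, 0 ≤ q ∧ q < 1 ∧ ∀ x x' : X,
      min ‖(1 / 2 : ℝ) • (x + x')‖ ‖(1 / 2 : ℝ) • (x - x')‖ ≤ q * max ‖x‖ ‖x'‖ := by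
  have hp0 : 0 < p := by linarith
  set σ := (2 * c) ^ p⁻¹
  have hσ0 : 0 ≤ σ := by positivity
  have hσp : σ ^ p = 2 * c := Real.rpow_inv_rpow (by positivity) hp0.ne'
  have hσ : σ < lam + mu := by
    rw [← hσp] at hc
    exact (Real.rpow_lt_rpow_iff hσ0 (by positivity) hp0).1 hc
  have hM : 0 < max lam mu := lt_max_of_lt_left hlam
  have hsum : 2 * max lam mu = lam + mu + |lam - mu| := by
    rcases le_total lam mu with h | h
    · rw [max_eq_right h, abs_of_nonpos (by linarith)]; ring
    · rw [max_eq_left h, abs_of_nonneg (by linarith)]; ring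
  have hd := abs_nonneg (lam - mu)
  refine ⟨(σ + |lam - mu|) / (2 * max lam mu), by positivity, ?_, fun x x' => ?_⟩
  · rw [div_lt_one (by positivity)]
    linarith
  set R := max ‖x‖ ‖x'‖
  have hR : 0 ≤ R := (norm_nonneg x).trans (le_max_left _ _)
  have hrem : ∀ e : ℝ, |e| = 1 →
      ‖(max lam mu - lam) • x + (e * (max lam mu - mu)) • x'‖ ≤ |lam - mu| * R ∧
      ‖(max lam mu - mu) • x + (e * (max lam mu - lam)) • x'‖ ≤ |lam - mu| * R := by
    intro e he
    have h1 : 0 ≤ max lam mu - lam := sub_nonneg.2 (le_max_left _ _)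
    have h2 : 0 ≤ max lam mu - mu := sub_nonneg.2 (le_max_right _ _)
    have h3 : ∀ a b : ℝ, 0 ≤ a → 0 ≤ b → ‖a • x + (e * b) • x'‖ ≤ (a + b) * R := by
      intro a b ha hb
      refine (norm_add_le _ _).trans ?_
      rw [norm_smul, norm_smul, norm_mul, Real.norm_of_nonneg ha, Real.norm_of_nonneg hb,
        Real.norm_eq_abs, he, one_mul, add_mul]
      gcongr
      · exact le_max_left _ _
      · exact le_max_right _ _
    have h4 : |lam - mu| = (max lam mu - lam) + (max lam mu - mu) := by linarith
    rw [h4]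
    exact ⟨h3 _ _ h1 h2, (h3 _ _ h2 h1).trans_eq (by rw [add_comm])⟩
  have hfinish : ∀ z r s : X, max lam mu • z = r + s → ‖r‖ ^ p ≤ (σ * R) ^ p →
      ‖s‖ ≤ |lam - mu| * R →
      ‖(1 / 2 : ℝ) • z‖ ≤ (σ + |lam - mu|) / (2 * max lam mu) * R := by
    intro z r s hz hr hs
    have hr' := (Real.rpow_le_rpow_iff (norm_nonneg r) (by positivity) hp0).1 hr
    have h1 : max lam mu * ‖z‖ ≤ (σ + |lam - mu|) * R := by
      rw [← Real.norm_of_nonneg hM.le, ← norm_smul, hz]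
      refine (norm_add_le _ _).trans ?_
      linarith
    have h2 : ‖(1 / 2 : ℝ) • z‖ = ‖z‖ / 2 := by
      rw [norm_smul, Real.norm_of_nonneg (by norm_num)]
      ring
    rw [h2, div_mul_eq_mul_div _ (2 * max lam mu), le_div_iff₀ (by positivity)]
    linarith
  have hmin : min (‖lam • x + mu • x'‖ ^ p) (‖mu • x - lam • x'‖ ^ p) ≤ (σ * R) ^ p := by
    refine (h x x').trans ?_
    rw [Real.mul_rpow hσ0 hR, hσp]
    have h1 : ‖x‖ ^ p ≤ R ^ p := Real.rpow_le_rpow (norm_nonneg _) (le_max_left _ _) hp0.le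
    have h2 : ‖x'‖ ^ p ≤ R ^ p := Real.rpow_le_rpow (norm_nonneg _) (le_max_right _ _) hp0.le
    calc c * (‖x‖ ^ p + ‖x'‖ ^ p) ≤ c * (R ^ p + R ^ p) := by gcongr
      _ = 2 * c * R ^ p := by ring
  rcases min_le_iff.1 hmin with h1 | h1
  · refine (min_le_left _ _).trans (hfinish (x + x') _ _ ?_ h1 (hrem 1 abs_one).1)
    module
  · refine (min_le_right _ _).trans (hfinish (x - x') _ _ ?_ h1 (hrem (-1) (by simp)).2)
    module

/-- The Domínguez–Lorenzo inequality: points of an asymptotic center are uniformly closer to the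
weak limit than the asymptotic radius. -/
theorem SkewIneq.dist_weakLim_le (hX : HasWeakLimits X) (hp : 1 ≤ p) (hlam : 0 < lam) (hmu : 0 < mu)
    {c : ℝ} (hc0 : 0 ≤ c) (h : SkewIneq X p lam mu c) (hw : 1 ≤ weakOrthCoeff X) {κ : ℝ}
    (hβ : 0 < min lam mu * (weakOrthCoeff X ^ 2 + 1) - |lam - mu| * weakOrthCoeff X) (hκ : 0 ≤ κ)
    (hcκ : c * (weakOrthCoeff X ^ p * (weakOrthCoeff X ^ p + 1)) =
      (κ * (min lam mu * (weakOrthCoeff X ^ 2 + 1) - |lam - mu| * weakOrthCoeff X)) ^ p)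
    {C : Set X} (hC : Convex ℝ C) {U : Ultrafilter ℕ} {x : ℕ → X} {M : ℝ} (hx : ∀ n, ‖x n‖ ≤ M)
    {w z : X} (hxw : WeakLim U x w) (hwC : w ∈ C) (hzC : z ∈ C) {r : ℝ}
    (hr : Tendsto (fun n => ‖x n - z‖) U (𝓝 r))
    (hrmin : ∀ v ∈ C, r ≤ ulim U fun n => ‖x n - v‖) :
    ‖w - z‖ ≤ κ * r := by
  set ω := weakOrthCoeff X
  set β := min lam mu * (ω ^ 2 + 1) - |lam - mu| * ω with hβdef
  have hp0 : 0 < p := by linarith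
  have hω0 : 0 < ω := by linarith
  have hlim : ∀ (s : ℝ) (v : X), Tendsto (fun n => ‖s • x n - v‖) U
      (𝓝 (ulim U fun n => ‖s • x n - v‖)) := by
    intro s v
    refine tendsto_ulim U (M := |s| * M + ‖v‖) fun n => ?_
    rw [abs_norm]
    refine (norm_sub_le _ _).trans ?_
    rw [norm_smul, Real.norm_eq_abs]
    gcongr
    exact hx n
  have hr0 : 0 ≤ r := ge_of_tendsto' hr fun n => norm_nonneg _
  have hKr : ‖w - z‖ ≤ r := (hxw.sub (weakLim_const _ z)).norm_le hr
  set K := ‖w - z‖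
  have hK0 : 0 ≤ K := norm_nonneg _
  set a : ℕ → X := fun n => x n - z
  -- With `y n = x n - w` weakly null along `U`, `a n = y n - (z - w)` and `b n = y n + (z - w)`; so
  -- `ω` compares the limits of their norms.
  set b : ℕ → X := fun n => x n - (2 : ℝ) • w + z
  obtain ⟨B, hB⟩ : ∃ B, Tendsto (fun n => ‖b n‖) U (𝓝 B) := by
    refine ⟨_, (hlim 1 ((2 : ℝ) • w - z)).congr fun n => ?_⟩
    simp only [b]
    congr 1
    module
  have hB0 : 0 ≤ B := ge_of_tendsto' hB fun n => norm_nonneg _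
  have hBr : B ≤ ω * r := by
    have hy : WeakLim U (fun n => x n - w) 0 := by
      have := hxw.sub (weakLim_const U w)
      rwa [sub_self] at this
    refine le_weakOrthCoeff_mul hX (M := M + ‖w‖)
      (fun n => (norm_sub_le _ _).trans (by gcongr; exact hx n)) hy (v := z - w)
      (hB.congr fun n => ?_) (hr.congr fun n => ?_)
    · simp only [b]
      congr 1
      module
    · congr 1
      abel
  have hm : 0 < min lam mu := lt_min hlam hmu
  have hml : min lam mu ≤ lam := min_le_left _ _
  have hmm : min lam mu ≤ mu := min_le_right _ _
  have hd := abs_nonneg (lam - mu)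
  have hω2 : 1 ≤ ω ^ 2 := one_le_pow₀ hw
  -- Normalised by `s + t`, the subtracted vector is a point of the segment from `w` to `z` in `C`,
  -- to which minimality of `r` applies.
  have hseg : ∀ s t : ℝ, 0 ≤ s → 0 ≤ t → 0 < s + t →
      ∀ L, Tendsto (fun n => ‖(s + t) • x n - (s • w + t • z)‖) U (𝓝 L) → (s + t) * r ≤ L := by
    intro s t hs ht hst L hL
    have hv : (s / (s + t)) • w + (t / (s + t)) • z ∈ C :=
      hC hwC hzC (by positivity) (by positivity) (by field_simp)
    have h1 := hlim 1 ((s / (s + t)) • w + (t / (s + t)) • z)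
    simp only [one_smul] at h1
    have h2 : Tendsto (fun n => ‖(s + t) • x n - (s • w + t • z)‖) U
        (𝓝 ((s + t) * ulim U fun n => ‖x n - ((s / (s + t)) • w + (t / (s + t)) • z)‖)) := by
      refine (h1.const_mul (s + t)).congr fun n => ?_
      rw [← Real.norm_of_nonneg hst.le, ← norm_smul, Real.norm_of_nonneg hst.le, smul_sub, smul_add,
        smul_smul, smul_smul, mul_div_cancel₀ _ hst.ne', mul_div_cancel₀ _ hst.ne']
    rw [tendsto_nhds_unique hL h2]
    exact mul_le_mul_of_nonneg_left (hrmin _ hv) hst.le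
  obtain ⟨P, hP⟩ : ∃ P, Tendsto (fun n => ‖lam • ω ^ 2 • a n + mu • b n‖) U (𝓝 P) := by
    refine ⟨_, (hlim (lam * ω ^ 2 + mu) ((lam * ω ^ 2) • z + mu • ((2 : ℝ) • w - z))).congr
      fun n => ?_⟩
    simp only [a, b]
    congr 1
    module
  obtain ⟨N, hN⟩ : ∃ N, Tendsto (fun n => ‖mu • ω ^ 2 • a n - lam • b n‖) U (𝓝 N) := by
    refine ⟨_, (hlim (mu * ω ^ 2 - lam) ((mu * ω ^ 2) • z - lam • ((2 : ℝ) • w - z))).congr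
      fun n => ?_⟩
    simp only [a, b]
    congr 1
    module
  -- Weakly `a` tends to `w - z` and `b` to its negative, so in this combination the two
  -- contributions add up.
  have hNK : β * K ≤ N := by
    have h1 : WeakLim U (fun n => mu • ω ^ 2 • a n - lam • b n) ((mu * ω ^ 2 + lam) • (w - z)) := by
      have h2 := ((hxw.sub (weakLim_const U z)).const_smul (mu * ω ^ 2)).sub
        (((hxw.sub (weakLim_const U ((2 : ℝ) • w))).add (weakLim_const U z)).const_smul lam)
      convert h2 using 1
      · funext n
        simp only [a, b]
        module
      · module
    have h2 := h1.norm_le hN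
    rw [norm_smul, Real.norm_of_nonneg (by positivity)] at h2
    refine le_trans (mul_le_mul_of_nonneg_right ?_ hK0) h2
    have h3 : min lam mu * ω ^ 2 ≤ mu * ω ^ 2 := by gcongr
    have h4 : 0 ≤ |lam - mu| * ω := by positivity
    linarith
  have hPK : β * K ≤ P := by
    rcases le_total mu lam with hle | hle
    · have h1 := hseg (2 * mu) (lam * ω ^ 2 - mu) (by positivity) (by nlinarith) (by nlinarith) P
        (hP.congr fun n => by
          simp only [a, b]
          congr 1
          module)
      have h2 : β ≤ 2 * mu + (lam * ω ^ 2 - mu) := by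
        have h3 : min lam mu * ω ^ 2 ≤ lam * ω ^ 2 := by gcongr
        have h4 : 0 ≤ |lam - mu| * ω := by positivity
        linarith
      exact (mul_le_mul h2 hKr hK0 (by linarith)).trans h1
    -- Here the coefficient `lam * ω ^ 2 - mu` could be negative. Splitting off `(mu - lam) • b n`,
    -- of limit norm at most `(mu - lam) * ω * r`, leaves `lam` times a combination covered by
    -- `hseg`; this produces the bracket `β` exactly.
    · have h0 := hlim (2 + (ω ^ 2 - 1)) ((2 : ℝ) • w + (ω ^ 2 - 1) • z)
      have h1 := hseg 2 (ω ^ 2 - 1) (by norm_num) (by linarith) (by linarith) _ h0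
      have h2 := le_of_tendsto_of_tendsto' ((h0.const_mul lam).sub (hB.const_mul (mu - lam))) hP
        fun n => by
          have h3 : lam • ((2 + (ω ^ 2 - 1)) • x n - ((2 : ℝ) • w + (ω ^ 2 - 1) • z)) =
              (lam • ω ^ 2 • a n + mu • b n) - (mu - lam) • b n := by
            simp only [a, b]
            module
          have h4 := congrArg norm h3
          rw [norm_smul, Real.norm_of_nonneg hlam.le] at h4
          have h5 := norm_sub_le (lam • ω ^ 2 • a n + mu • b n) ((mu - lam) • b n)
          rw [norm_smul (mu - lam), Real.norm_of_nonneg (by linarith)] at h5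
          linarith
      have h3 := mul_le_mul_of_nonneg_left h1 hlam.le
      have h4 := mul_le_mul_of_nonneg_left hBr (by linarith : 0 ≤ mu - lam)
      have h5 : β * r = lam * ((2 + (ω ^ 2 - 1)) * r) - (mu - lam) * (ω * r) := by
        rw [hβdef, min_eq_left hle, abs_of_nonpos (by linarith)]
        ring
      have h6 := mul_le_mul_of_nonneg_left hKr hβ.le
      linarith
  have hlimit := le_of_tendsto_of_tendsto'
    ((hP.rpow_const (Or.inr hp0.le)).min (hN.rpow_const (Or.inr hp0.le)))
    ((((hr.const_mul (ω ^ 2)).rpow_const (Or.inr hp0.le)).add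
      (hB.rpow_const (p := p) (Or.inr hp0.le))).const_mul c) fun n => by
        have := h (ω ^ 2 • a n) (b n)
        rwa [norm_smul (ω ^ 2) (a n), Real.norm_of_nonneg (by positivity)] at this
  have hlow : (β * K) ^ p ≤ min (P ^ p) (N ^ p) :=
    le_min (Real.rpow_le_rpow (by positivity) hPK hp0.le)
      (Real.rpow_le_rpow (by positivity) hNK hp0.le)
  have hup : c * ((ω ^ 2 * r) ^ p + B ^ p) ≤ (κ * β * r) ^ p := by
    have h1 : B ^ p ≤ (ω * r) ^ p := Real.rpow_le_rpow hB0 hBr hp0.le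
    rw [Real.mul_rpow (mul_nonneg hκ hβ.le) hr0, ← hcκ]
    calc c * ((ω ^ 2 * r) ^ p + B ^ p) ≤ c * ((ω ^ 2 * r) ^ p + (ω * r) ^ p) := by gcongr
      _ = c * (ω ^ p * (ω ^ p + 1)) * r ^ p := by
        rw [sq, Real.mul_rpow (by positivity) hr0, Real.mul_rpow hω0.le hω0.le,
          Real.mul_rpow hω0.le hr0]
        ring
  have hfin := (Real.rpow_le_rpow_iff (by positivity) (by positivity) hp0).1
    ((hlow.trans hlimit).trans hup)
  exact le_of_mul_le_mul_left (by linarith : β * K ≤ β * (κ * r)) hβ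

end Constants


/-! ### Asymptotic centers and the fixed point iteration. -/

section FixedPoint

variable {X : Type*} [NormedAddCommGroup X]

/-- The asymptotic distance of the sequence `x` to the point `c` along `U`. -/
noncomputable def asympDist (U : Ultrafilter ℕ) (x : ℕ → X) (c : X) : ℝ :=
  ulim U fun n => ‖x n - c‖

variable {U : Ultrafilter ℕ} {x : ℕ → X} {M : ℝ}

theorem tendsto_asympDist (hx : ∀ n, ‖x n‖ ≤ M) (c : X) :
    Tendsto (fun n => ‖x n - c‖) U (𝓝 (asympDist U x c)) :=
  tendsto_ulim U (M := M + ‖c‖) fun n => by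
    rw [abs_norm]
    exact (norm_sub_le _ _).trans (by gcongr; exact hx n)

theorem asympDist_nonneg (hx : ∀ n, ‖x n‖ ≤ M) (c : X) : 0 ≤ asympDist U x c :=
  ge_of_tendsto' (tendsto_asympDist hx c) fun _ => norm_nonneg _

theorem norm_sub_le_asympDist_add (hx : ∀ n, ‖x n‖ ≤ M) (c c' : X) :
    ‖c - c'‖ ≤ asympDist U x c + asympDist U x c' :=
  ge_of_tendsto' ((tendsto_asympDist (U := U) hx c).add (tendsto_asympDist hx c')) fun n => by
    rw [norm_sub_rev (x n) c]
    exact norm_sub_le_norm_sub_add_norm_sub _ _ _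

theorem continuous_asympDist (hx : ∀ n, ‖x n‖ ≤ M) : Continuous (asympDist U x) := by
  refine (LipschitzWith.of_le_add fun c c' => ?_).continuous
  refine le_of_tendsto_of_tendsto' (tendsto_asympDist (U := U) hx c)
    ((tendsto_asympDist hx c').add_const _) fun n => ?_
  rw [dist_eq_norm, norm_sub_rev c]
  exact norm_sub_le_norm_sub_add_norm_sub _ _ _

theorem isClosed_sublevel_asympDist (hx : ∀ n, ‖x n‖ ≤ M) {C : Set X} (hC : IsClosed C) (s : ℝ) :
    IsClosed {c ∈ C | asympDist U x c ≤ s} :=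
  hC.inter (isClosed_le (continuous_asympDist hx) continuous_const)

variable [NormedSpace ℝ X]

/-- Compactness of `T y` makes the distance from `u` to `T y` attained, so there is no loss in the
constant. -/
theorem MultiNonexpansiveOn.multiLipschitzOn {T : X → Set X} {C : Set X} (hT : MapsToKC T C)
    (h : MultiNonexpansiveOn T C) : MultiLipschitzOn 1 T C := by
  intro x hx y hy u hu
  obtain ⟨v, hv, huv⟩ := (hT y hy).2.1.exists_infDist_eq_dist (hT y hy).1 u
  refine ⟨v, hv, ?_⟩
  rw [one_mul, ← dist_eq_norm, ← huv]
  exact (Metric.infDist_le_hausdorffDist_of_mem hu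
    (Metric.hausdorffEDist_ne_top_of_nonempty_of_bounded (hT x hx).1 (hT y hy).1
      (hT x hx).2.1.isBounded (hT y hy).2.1.isBounded)).trans (h x hx y hy)

theorem convexOn_asympDist (hx : ∀ n, ‖x n‖ ≤ M) : ConvexOn ℝ Set.univ (asympDist U x) := by
  refine ⟨convex_univ, fun c _ c' _ a b ha hb hab => ?_⟩
  refine le_of_tendsto_of_tendsto' (tendsto_asympDist (U := U) hx _)
    (((tendsto_asympDist hx c).const_mul a).add ((tendsto_asympDist hx c').const_mul b))
    fun n => ?_
  have : x n - (a • c + b • c') = a • (x n - c) + b • (x n - c') := by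
    rw [smul_sub, smul_sub, sub_add_sub_comm, ← add_smul, hab, one_smul]
  rw [this]
  refine (norm_add_le _ _).trans (le_of_eq ?_)
  rw [norm_smul, norm_smul, Real.norm_of_nonneg ha, Real.norm_of_nonneg hb]

theorem convex_sublevel_asympDist (hx : ∀ n, ‖x n‖ ≤ M) {C : Set X} (hC : Convex ℝ C) (s : ℝ) :
    Convex ℝ {c ∈ C | asympDist U x c ≤ s} := by
  have := hC.inter ((convexOn_asympDist (U := U) hx).convex_le s)
  simpa [Set.inter_def] using this

/-- Asymptotic centers are nonempty. -/
theorem exists_asympDist_le (hX : HasWeakLimits X) (hx : ∀ n, ‖x n‖ ≤ M) {C : Set X}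
    (hne : C.Nonempty) (hb : Bornology.IsBounded C) (hC : IsClosed C) (hCc : Convex ℝ C) :
    ∃ z ∈ C, ∀ c ∈ C, asympDist U x z ≤ asympDist U x c := by
  have hbdd : BddBelow (asympDist U x '' C) :=
    ⟨0, by rintro _ ⟨c, -, rfl⟩; exact asympDist_nonneg hx c⟩
  obtain ⟨u, -, hu, huC⟩ := exists_seq_tendsto_sInf (hne.image (asympDist U x)) hbdd
  choose c hcC hcu using huC
  obtain ⟨R, hR⟩ := hb.exists_norm_le
  let V : Ultrafilter ℕ := hyperfilter ℕ
  obtain ⟨z, hz⟩ := hX V c R fun n => hR _ (hcC n)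
  have hlim : Tendsto u V (𝓝 (sInf (asympDist U x '' C))) := hu.mono_left Nat.hyperfilter_le_atTop
  -- Sublevel sets are closed and convex, so they contain the weak limit of a minimising sequence.
  have hmem : ∀ s, sInf (asympDist U x '' C) < s → z ∈ {c ∈ C | asympDist U x c ≤ s} := fun s hs =>
    hz.mem (isClosed_sublevel_asympDist hx hC s) (convex_sublevel_asympDist hx hCc s)
      ((hlim.eventually_lt_const hs).mono fun n hn => ⟨hcC n, (hcu n).trans_le hn.le⟩)
  refine ⟨z, (hmem _ (lt_add_one _)).1, fun c hc => ?_⟩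
  refine le_of_forall_pos_le_add fun ε hε => (hmem _ ?_).2
  exact (csInf_le hbdd ⟨c, hc, rfl⟩).trans_lt (lt_add_of_pos_right _ hε)

/-- The values of a nonexpansive map contain points whose asymptotic distance to an approximate
fixed point sequence is not increased. -/
theorem exists_mem_asympDist_le {T : X → Set X} {C : Set X} (hT : MapsToKC T C)
    (hTne : MultiLipschitzOn 1 T C) (hx : ∀ n, ‖x n‖ ≤ M) (hxC : ∀ n, x n ∈ C) {v : ℕ → X}
    (hv : ∀ n, v n ∈ T (x n)) (hxv : Tendsto (fun n => ‖x n - v n‖) U (𝓝 0)) {z : X} (hz : z ∈ C) :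
    ∃ u ∈ T z, asympDist U x u ≤ asympDist U x z := by
  choose u huT huv using fun n => hTne (x n) (hxC n) z hz (v n) (hv n)
  obtain ⟨w, hw, hlim⟩ := (hT z hz).2.1.ultrafilter_le_nhds (U.map u)
    (le_principal_iff.2 (Filter.mem_map.2 (univ_mem' huT)))
  have hlim' : Tendsto (fun n => ‖u n - w‖) U (𝓝 0) := tendsto_iff_norm_sub_tendsto_zero.1 hlim
  refine ⟨w, hw, ?_⟩
  have h := (hxv.add (tendsto_asympDist (U := U) hx z)).add hlim'
  rw [zero_add, add_zero] at h
  refine le_of_tendsto_of_tendsto' (tendsto_asympDist hx w) h fun n => ?_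
  have h1 := huv n
  rw [one_mul] at h1
  calc ‖x n - w‖ = ‖(x n - v n) + (v n - u n) + (u n - w)‖ := by congr 1; abel
    _ ≤ ‖x n - v n‖ + ‖v n - u n‖ + ‖u n - w‖ := norm_add₃_le
    _ ≤ _ := by gcongr

/-- `c` lies within asymptotic distance `r` of an approximate fixed point sequence of `T` in `C`. -/
def NearFixed (T : X → Set X) (C : Set X) (c : X) (r : ℝ) : Prop :=
  c ∈ C ∧ ∃ x v : ℕ → X, (∀ n, x n ∈ C) ∧ (∀ n, v n ∈ T (x n)) ∧
    Tendsto (fun n => ‖x n - v n‖) (hyperfilter ℕ : Ultrafilter ℕ) (𝓝 0) ∧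
    asympDist (hyperfilter ℕ) x c ≤ r

/-- The fixed point theorem of Domínguez Benavides and Lorenzo: the hypothesis `hDL` says that
asymptotic centers have small Chebyshev radius relative to the asymptotic radius. -/
theorem exists_fixed_of_asymptotic_centers [CompleteSpace X] (hX : HasWeakLimits X) {κ : ℝ}
    (hκ0 : 0 ≤ κ) (hκ1 : κ < 1) {C : Set X} (hne : C.Nonempty) (hb : Bornology.IsBounded C)
    (hC : IsClosed C) (hCc : Convex ℝ C)
    (hDL : ∀ (U : Ultrafilter ℕ) (x : ℕ → X) (M : ℝ), (∀ n, ‖x n‖ ≤ M) → ∀ w z : X,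
      WeakLim U x w → w ∈ C → z ∈ C → (∀ c ∈ C, asympDist U x z ≤ asympDist U x c) →
      ‖w - z‖ ≤ κ * asympDist U x z)
    {T : X → Set X} (hT : MapsToKC T C) (hTne : MultiLipschitzOn 1 T C) : ∃ x ∈ C, x ∈ T x := by
  obtain ⟨M, hM⟩ := hb.exists_norm_le
  have happrox : ∀ A ⊆ C, IsClosed A → Convex ℝ A → A.Nonempty → (∀ x ∈ A, (T x ∩ A).Nonempty) →
      ∃ x v : ℕ → X, (∀ n, x n ∈ A) ∧ (∀ n, v n ∈ T (x n)) ∧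
        Tendsto (fun n => ‖x n - v n‖) (hyperfilter ℕ : Ultrafilter ℕ) (𝓝 0) := by
    intro A hAC hA hAc hAne hTA
    choose x hxA v hv hxv using fun n : ℕ => exists_approx_fixed hCc hb hA hAc hAne hAC hT hTne hTA
      (ε := 1 / ((n : ℝ) + 1)) (by positivity)
    exact ⟨x, v, hxA, hv, (squeeze_zero (fun n => norm_nonneg _) hxv
      tendsto_one_div_add_atTop_nhds_zero_nat).mono_left Nat.hyperfilter_le_atTop⟩
  have hstep : ∀ c r, NearFixed T C c r → ∃ c', NearFixed T C c' (κ * r) ∧ ‖c - c'‖ ≤ 3 * r := by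
    rintro c r ⟨hc, x, v, hxC, hv, hxv, hr⟩
    have hx : ∀ n, ‖x n‖ ≤ M := fun n => hM _ (hxC n)
    set U : Ultrafilter ℕ := hyperfilter ℕ
    obtain ⟨z₀, hz₀, hmin⟩ := exists_asympDist_le (U := U) hX hx hne hb hC hCc
    set ρ := asympDist U x z₀
    have hρr : ρ ≤ r := (hmin c hc).trans hr
    obtain ⟨w, hw⟩ := hX U x M hx
    have hwC : w ∈ C := hw.mem hC hCc (Eventually.of_forall hxC)
    have hball : ∀ z ∈ {c ∈ C | asympDist U x c ≤ ρ}, ‖w - z‖ ≤ κ * ρ := by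
      rintro z ⟨hz, hzρ⟩
      exact (hDL U x M hx w z hw hwC hz fun c hc => hzρ.trans (hmin c hc)).trans
        (mul_le_mul_of_nonneg_left hzρ hκ0)
    obtain ⟨x', v', hx'A, hv', hxv'⟩ := happrox {c ∈ C | asympDist U x c ≤ ρ} (fun c hc => hc.1)
      (isClosed_sublevel_asympDist hx hC ρ) (convex_sublevel_asympDist hx hCc ρ)
      ⟨z₀, hz₀, le_rfl⟩ (by
        rintro z ⟨hz, hzρ⟩
        obtain ⟨u, hu, huz⟩ := exists_mem_asympDist_le hT hTne hx hxC hv hxv hz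
        exact ⟨u, hu, (hT z hz).2.2.2 hu, huz.trans hzρ⟩)
    -- The next point is the weak limit `w` of the old sequence; the new sequence lies in the
    -- asymptotic center, hence within `κ * ρ` of `w`.
    refine ⟨w, ⟨hwC, x', v', fun n => (hx'A n).1, hv', hxv', ?_⟩, ?_⟩
    · refine le_of_tendsto' (tendsto_asympDist (fun n => hM _ (hx'A n).1) w) fun n => ?_
      rw [norm_sub_rev]
      exact (hball _ (hx'A n)).trans (mul_le_mul_of_nonneg_left hρr hκ0)
    · have h1 := norm_sub_le_asympDist_add (U := U) hx c z₀
      have h2 := hball z₀ ⟨hz₀, le_rfl⟩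
      have h3 := norm_sub_le_norm_sub_add_norm_sub c z₀ w
      have h4 : κ * ρ ≤ 1 * ρ := mul_le_mul_of_nonneg_right hκ1.le (asympDist_nonneg hx z₀)
      rw [norm_sub_rev z₀ w] at h3
      linarith
  have hnear : ∀ c r, NearFixed T C c r → ∃ u ∈ T c, ‖c - u‖ ≤ 2 * r := by
    rintro c r ⟨hc, x, v, hxC, hv, hxv, hr⟩
    have hx : ∀ n, ‖x n‖ ≤ M := fun n => hM _ (hxC n)
    obtain ⟨u, hu, huc⟩ := exists_mem_asympDist_le hT hTne hx hxC hv hxv hc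
    refine ⟨u, hu, (norm_sub_le_asympDist_add (U := hyperfilter ℕ) hx c u).trans ?_⟩
    linarith
  obtain ⟨c₀, hc₀⟩ := hne
  obtain ⟨x, v, hxC, hv, hxv⟩ := happrox C subset_rfl hC hCc ⟨c₀, hc₀⟩ fun x hx =>
    let ⟨u, hu⟩ := (hT x hx).1
    ⟨u, hu, (hT x hx).2.2.2 hu⟩
  set r := asympDist (hyperfilter ℕ) x c₀
  choose! g hg hgdist using hstep
  let s : ℕ → X := fun k => Nat.rec c₀ (fun k c => g c (r * κ ^ k)) k
  have hs : ∀ k, NearFixed T C (s k) (r * κ ^ k) := by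
    intro k
    induction k with
    | zero => exact ⟨hc₀, x, v, hxC, hv, hxv, by simp [s, r]⟩
    | succ k ih =>
      have := hg _ _ ih
      rw [pow_succ, ← mul_assoc, mul_comm _ κ]
      exact this
  have hcauchy : CauchySeq s := cauchySeq_of_le_geometric κ (3 * r) hκ1 fun k => by
    rw [dist_eq_norm, mul_assoc]
    exact hgdist _ _ (hs k)
  obtain ⟨c, hc⟩ := cauchySeq_tendsto_of_complete hcauchy
  have hcC : c ∈ C := hC.mem_of_tendsto hc (Eventually.of_forall fun k => (hs k).1)
  refine ⟨c, hcC, ?_⟩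
  choose u hu hsu using fun k => hnear _ _ (hs k)
  choose u' hu' huu' using fun k => hTne (s k) (hs k).1 c hcC (u k) (hu k)
  -- The points `u' k ∈ T c` approach `c`: the terms bound `‖s k - u k‖`, `‖u k - u' k‖` and `‖s k -
  -- c‖`. Closedness of `T c` then gives `c ∈ T c`.
  have hzero : Tendsto (fun k => 2 * (r * κ ^ k) + 1 * ‖s k - c‖ + ‖s k - c‖) atTop (𝓝 0) := by
    have h1 := tendsto_iff_norm_sub_tendsto_zero.1 hc
    have h2 := ((tendsto_pow_atTop_nhds_zero_of_lt_one hκ0 hκ1).const_mul r).const_mul 2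
    simpa using (h2.add (h1.const_mul 1)).add h1
  have hlim : Tendsto u' atTop (𝓝 c) := by
    rw [tendsto_iff_norm_sub_tendsto_zero]
    refine squeeze_zero (fun k => norm_nonneg _) (fun k => ?_) hzero
    calc ‖u' k - c‖ = ‖(u' k - u k) + (u k - s k) + (s k - c)‖ := by congr 1; abel
      _ ≤ ‖u' k - u k‖ + ‖u k - s k‖ + ‖s k - c‖ := norm_add₃_le
      _ ≤ _ := by
        rw [norm_sub_rev (u' k), norm_sub_rev (u k) (s k)]
        linarith [huu' k, hsu k]
  exact (hT c hcC).2.1.isClosed.mem_of_tendsto hlim (Eventually.of_forall hu')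

end FixedPoint

end SkewVNJ

/-! ### The main theorem. -/

theorem mainTheorem3 {X : Type*} [NormedAddCommGroup X] [NormedSpace ℝ X] [CompleteSpace X]
    (hdim : 2 ≤ Module.rank ℝ X)
    (p lam mu : ℝ) (hp : 1 ≤ p) (hlam : 0 < lam) (hmu : 0 < mu)
    (hC : SkewVNJ.skewConst p lam mu X <
      (min lam mu * (SkewVNJ.weakOrthCoeff X ^ 2 + 1) - |lam - mu| * SkewVNJ.weakOrthCoeff X) ^ p /
        ((2 : ℝ) ^ (p - 3) * (lam ^ p + mu ^ p) * SkewVNJ.weakOrthCoeff X ^ p *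
          (SkewVNJ.weakOrthCoeff X ^ p + 1)))
    (C : Set X) (hne : C.Nonempty) (hbdd : Bornology.IsBounded C) (hclosed : IsClosed C)
    (hconv : Convex ℝ C)
    (T : X → Set X) (hT : SkewVNJ.MapsToKC T C) (hTne : SkewVNJ.MultiNonexpansiveOn T C) :
    ∃ x ∈ C, x ∈ T x := by
  have : Nontrivial X := by
    rw [← rank_pos_iff_nontrivial (R := ℝ)]
    exact two_pos.trans_le hdim
  have hp0 : 0 < p := by linarith
  have hω := SkewVNJ.one_le_weakOrthCoeff (X := X)
  have hineq := SkewVNJ.skewIneq_skewConst (X := X) hp hlam hmu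
  set ω := SkewVNJ.weakOrthCoeff X
  set D := (2 : ℝ) ^ (p - 3) * (lam ^ p + mu ^ p)
  set β := min lam mu * (ω ^ 2 + 1) - |lam - mu| * ω
  set c := SkewVNJ.skewConst p lam mu X * D with hcdef
  have hω0 : 0 < ω := by linarith
  have hD : 0 < D := by positivity
  have hc : c * (ω ^ p * (ω ^ p + 1)) < β ^ p := by
    rw [lt_div_iff₀ (by positivity)] at hC
    calc c * (ω ^ p * (ω ^ p + 1)) = SkewVNJ.skewConst p lam mu X * (D * ω ^ p * (ω ^ p + 1)) := by
          rw [hcdef]; ring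
      _ < β ^ p := hC
  have hc0 : 0 ≤ c := by
    have h1 := hineq.sub_rpow_le hp hlam hmu
    have h2 := Real.rpow_nonneg (abs_nonneg (lam - mu)) p
    linarith
  obtain ⟨hβ, hsq⟩ := SkewVNJ.bracket_pos_and_nonsquare hp hlam hmu hω hineq hc
  obtain ⟨q, hq0, hq1, hq⟩ := hineq.nonsquare hp hlam hmu hc0 hsq
  have hX : SkewVNJ.HasWeakLimits X := fun U y M hy => SkewVNJ.exists_weak_ulim hq0 hq1 hq U hy
  set e := c * (ω ^ p * (ω ^ p + 1))
  have he : 0 ≤ e := by positivity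
  -- The contraction constant is `κ = e ^ p⁻¹ / β`; the hypothesis `e < β ^ p` says precisely that
  -- `κ < 1`.
  have hκ : e = (e ^ p⁻¹ / β * β) ^ p := by
    rw [div_mul_cancel₀ _ hβ.ne', Real.rpow_inv_rpow he hp0.ne']
  have hκ0 : 0 ≤ e ^ p⁻¹ / β := by positivity
  refine SkewVNJ.exists_fixed_of_asymptotic_centers hX (κ := e ^ p⁻¹ / β) hκ0 ?_
    hne hbdd hclosed hconv (fun U x M hx w z hw hwC hzC hmin => ?_) hT (hTne.multiLipschitzOn hT)
  · rw [div_lt_one hβ, ← Real.rpow_lt_rpow_iff (by positivity) hβ.le hp0,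
      Real.rpow_inv_rpow he hp0.ne']
    exact hc
  · exact hineq.dist_weakLim_le hX hp hlam hmu hc0 hω hβ hκ0 hκ hconv hx hw hwC hzC
      (SkewVNJ.tendsto_asympDist hx z) hmin
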